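/- Let $X=\Gamma\backslash G$ be a $6$-dimensional nilmanifold, that is, a compact quotient of a connected, simply connected, $6$-dimensional real nilpotent Lie group $G$ (a connected Lie group whose Lie algebra $\mathfrak g$ is nilpotent) by a discrete subgroup $\Gamma$. Let $J$ be a left-invariant (integrable) complex structure on $X$, i.e. one induced by a complex structure on $G$ that is invariant under left translations. A left-invariant $J$-Hermitian metric $g$ is called pluriclosed (or SKT) if its fundamental form $\omega=g(J\cdot,\cdot)$ satisfies $\partial\overline\partial\omega=0$. We describe a real Lie algebra by structure equations: $\mathfrak g\cong(\theta^1,\dots,\theta^6)$ means that $\mathfrak g$ has a basis whose dual basis $e^1,\dots,e^6$ satisfies $de^k=\theta^k$, where $d\alpha=-\alpha([\cdot,\cdot])$ and $ij$ stands for $e^i\wedge e^j$. Put $$\mathfrak h_1=(0,0,0,0,0,0),\quad \mathfrak h_2=(0,0,0,0,12,34),\quad \mathfrak h_4=(0,0,0,0,12,14+23),$$ $$\mathfrak h_5=(0,0,0,0,13+42,14+23),\quad \mathfrak h_8=(0,0,0,0,0,12).$$ Similarly, $J\cong(0,0,\theta)$ means that there is a left-invariant coframe $\omega^1,\omega^2,\omega^3$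 of the bundle of $(1,0)$-forms of $(X,J)$ with $d\omega^1=d\omega^2=0$ and $d\omega^3=\theta$; here $\omega^{ij}=\omega^i\wedge\omega^j$ and $\omega^{i\bar j}=\omega^i\wedge\overline{\omega^j}$. Then $(X,J)$ admits a left-invariant pluriclosed Hermitian metric if and only if one of the following holds: - [00] $\mathfrak g\cong\mathfrak h_1$ and $J\cong(0,0,0)$; - [01b] $\mathfrak g\cong\mathfrak h_2$ and $J\cong(0,0,\omega^{1\bar1}+i\,\omega^{2\bar2})$; - [02b] $\mathfrak g\cong\mathfrak h_2$ and $J\cong(0,0,\omega^{12}+\omega^{1\bar1}+\omega^{1\bar2}+D\,\omega^{2\bar2})$ for some $D\in\mathbb C$ with $\operatorname{Re}D=1$ and $\operatorname{Im}D>0$; - [06b] $\mathfrak g\cong\mathfrak h_4$ and $J\cong(0,0,\omega^{12}+\omega^{1\bar1}+\omega^{1\bar2}+\omega^{2\bar2})$; - [09b'] $\mathfrak g\cong\mathfrak h_5$ and $J\cong(0,0,\omega^{12}+\omega^{1\bar1}+(\tfrac12+iy)\,\omega^{2\bar2})$ for some real $y>0$ with $4y^2<3$; - [09c] $\mathfrak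 g\cong\mathfrak h_5$ and $J\cong(0,0,\omega^{12}+\omega^{1\bar1}+\tfrac12\,\omega^{2\bar2})$; - [12] $\mathfrak g\cong\mathfrak h_8$ and $J\cong(0,0,\omega^{1\bar1})$. -/

import Mathlib

open scoped Manifold ContDiff

noncomputable section

/-- The Lie bracket of a smooth real Lie group needs the smoothness order `minSmoothness ℝ 3 = 3`. -/
instance instLEInftyMinSmoothnessThree : ENat.LEInfty (minSmoothness ℝ 3) :=
  ⟨by
    rw [minSmoothness_of_isRCLikeNormedField]
    exact ENat.LEInfty.out⟩

namespace NilSKT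

/-- The tangent space of a `6`-dimensional real manifold at `x`. -/
abbrev Tan {G : Type*} [TopologicalSpace G] [ChartedSpace (EuclideanSpace ℝ (Fin 6)) G]
    (x : G) : Type :=
  TangentSpace (𝓡 6) x

/-- Complex-valued `k`-forms on `G`, as functions of a point and `k` real tangent vectors at it.
The operators below make sense on all such functions; they are only applied to forms that are
real multilinear and alternating at every point. -/
abbrev CForm (G : Type*) [TopologicalSpace G] [ChartedSpace (EuclideanSpace ℝ (Fin 6)) G]
    (k : ℕ) : Type _ :=
  ∀ x : G, (Fin k → Tan x) → ℂ

section LieGroupOperators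

variable {G : Type*} [TopologicalSpace G] [ChartedSpace (EuclideanSpace ℝ (Fin 6)) G] [Group G]

/-- The differential at `x` of the left translation by `a`. -/
def dLeft (a x : G) : Tan x →L[ℝ] Tan (a * x) :=
  mfderiv (𝓡 6) (𝓡 6) (fun y : G => a * y) x

/-- The left translate to the identity of a tangent vector at `x`. -/
def toIdentity (x : G) (v : Tan x) : GroupLieAlgebra (𝓡 6) G :=
  (mfderiv (𝓡 6) (𝓡 6) (fun y : G => x⁻¹ * y) x v : EuclideanSpace ℝ (Fin 6))

/-- The left-invariant vector field on `G` whose value at `x` is `v`. -/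
def leftInvExt (x : G) (v : Tan x) : ∀ y : G, Tan y :=
  mulInvariantVectorField (I := 𝓡 6) (toIdentity x v)

/-- The exterior derivative of a form of positive degree, computed by the invariant formula
`dα(X₀,…) = ∑ᵢ (-1)ⁱ Xᵢ(α(…,X̂ᵢ,…)) + ∑_{i<j} (-1)^(i+j) α([Xᵢ,Xⱼ],…,X̂ᵢ,…,X̂ⱼ,…)`, where the given
tangent vectors are extended to left-invariant vector fields `Xᵢ`. The pairs `i < j` of the formula
are written `(i.castSucc, j.succ)` with `i ≤ j`, hence the minus sign in front of the second sum. -/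
def extDer {k : ℕ} (α : CForm G (k + 1)) : CForm G (k + 2) := fun x v =>
  (∑ i : Fin (k + 2), (-1 : ℂ) ^ (i : ℕ) *
      (show ℂ from mfderiv (𝓡 6) 𝓘(ℝ, ℂ)
        (fun y : G => α y (fun m => leftInvExt x (i.removeNth v m) y)) x (v i))) -
    ∑ i : Fin (k + 1), ∑ j ∈ Finset.Ici i, (-1 : ℂ) ^ ((i : ℕ) + (j : ℕ)) *
      α x (Matrix.vecCons
        (VectorField.mlieBracket (𝓡 6) (leftInvExt x (v i.castSucc)) (leftInvExt x (v j.succ)) x)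
        (j.removeNth (i.castSucc.removeNth v)))

end LieGroupOperators

/-- A left-invariant (integrable) complex structure on `G`, equivalently on a quotient of `G` by a
discrete subgroup acting by left translations: a left-invariant endomorphism field `J` with
`J² = -1` and vanishing Nijenhuis tensor. -/
structure LeftInvariantComplexStructure (G : Type*) [TopologicalSpace G]
    [ChartedSpace (EuclideanSpace ℝ (Fin 6)) G] [Group G] [LieGroup (𝓡 6) ∞ G] where
  /-- The endomorphism of each tangent space. -/
  J : ∀ x : G, Tan x →L[ℝ] Tan x
  left_inv : ∀ (a x : G) (v : Tan x), J (a * x) (dLeft a x v) = dLeft a x (J x v)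
  sq_eq_neg : ∀ (x : G) (v : Tan x), J x (J x v) = -v
  nijenhuis : ∀ X Y : (∀ x : G, Tan x),
    ContMDiff (𝓡 6) (𝓡 6).tangent 1 (fun x => (⟨x, X x⟩ : TangentBundle (𝓡 6) G)) →
    ContMDiff (𝓡 6) (𝓡 6).tangent 1 (fun x => (⟨x, Y x⟩ : TangentBundle (𝓡 6) G)) →
    ∀ x : G,
      VectorField.mlieBracket (𝓡 6) (fun y => J y (X y)) (fun y => J y (Y y)) x
        - J x (VectorField.mlieBracket (𝓡 6) (fun y => J y (X y)) Y x)
        - J x (VectorField.mlieBracket (𝓡 6) X (fun y => J y (Y y)) x)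
        - VectorField.mlieBracket (𝓡 6) X Y x = 0

section Structures

variable {G : Type*} [TopologicalSpace G] [ChartedSpace (EuclideanSpace ℝ (Fin 6)) G] [Group G]
  [LieGroup (𝓡 6) ∞ G]

/-- The component of type `(p, k - p)` of a complex-valued `k`-form. It is the sum, over all sets
`S` of `p` slots, of the form (extended complex multilinearly) with `(v - iJv)/2` in the slots of
`S` and `(v + iJv)/2` in the other slots; the products are expanded over the set `T` of the slots
in which `Jv` is chosen. -/
def typeComponent (𝒥 : LeftInvariantComplexStructure G) {k : ℕ} (p : ℕ) (α : CForm G k) :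
    CForm G k := fun x v =>
  ∑ S ∈ Finset.powersetCard p (Finset.univ : Finset (Fin k)), ∑ T : Finset (Fin k),
    (1 / 2 : ℂ) ^ k * (∏ i ∈ T, if i ∈ S then -Complex.I else Complex.I) *
      α x (fun i => if i ∈ T then 𝒥.J x (v i) else v i)

/-- The operator `∂`: on forms of type `(p, q)` it is the component of type `(p + 1, q)` of `d`. -/
def del (𝒥 : LeftInvariantComplexStructure G) {k : ℕ} (α : CForm G (k + 1)) : CForm G (k + 2) :=
  ∑ p ∈ Finset.range (k + 2), typeComponent 𝒥 (p + 1) (extDer (typeComponent 𝒥 p α))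

/-- The operator `∂̄`: on forms of type `(p, q)` it is the component of type `(p, q + 1)` of `d`. -/
def delbar (𝒥 : LeftInvariantComplexStructure G) {k : ℕ} (α : CForm G (k + 1)) :
    CForm G (k + 2) :=
  ∑ p ∈ Finset.range (k + 2), typeComponent 𝒥 p (extDer (typeComponent 𝒥 p α))

/-- A left-invariant Riemannian metric that is Hermitian for the complex structure. -/
structure LeftInvariantHermitianMetric (𝒥 : LeftInvariantComplexStructure G) where
  /-- The inner product on each tangent space. -/
  g : ∀ x : G, Tan x →ₗ[ℝ] Tan x →ₗ[ℝ] ℝ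
  symm : ∀ (x : G) (u v : Tan x), g x u v = g x v u
  pos : ∀ (x : G) (v : Tan x), v ≠ 0 → 0 < g x v v
  hermitian : ∀ (x : G) (u v : Tan x), g x (𝒥.J x u) (𝒥.J x v) = g x u v
  left_inv : ∀ (a x : G) (u v : Tan x), g (a * x) (dLeft a x u) (dLeft a x v) = g x u v

/-- The fundamental form `ω = g(J·, ·)`. -/
def fundamentalForm {𝒥 : LeftInvariantComplexStructure G} (h : LeftInvariantHermitianMetric 𝒥) :
    CForm G 2 := fun x v =>
  ((h.g x (𝒥.J x (v 0)) (v 1) : ℝ) : ℂ)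

/-- A Hermitian metric is pluriclosed (SKT) if `∂∂̄ω = 0`. -/
def IsPluriclosed {𝒥 : LeftInvariantComplexStructure G} (h : LeftInvariantHermitianMetric 𝒥) :
    Prop :=
  del 𝒥 (delbar 𝒥 (fundamentalForm h)) = 0

/-- A complex-valued `1`-form as an element of `CForm G 1`. -/
def oneForm (η : ∀ x : G, Tan x →ₗ[ℝ] ℂ) : CForm G 1 := fun x v => η x (v 0)

/-- The wedge product of two `1`-forms. -/
def wedge (α β : CForm G 1) : CForm G 2 := fun x v =>
  α x ![v 0] * β x ![v 1] - α x ![v 1] * β x ![v 0]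

/-- The complex conjugate of a form. -/
def conjForm {k : ℕ} (α : CForm G k) : CForm G k := fun x v => (starRingEnd ℂ) (α x v)

/-- A left-invariant coframe of the bundle of `(1,0)`-forms. -/
structure IsLeftInvariantCoframe (𝒥 : LeftInvariantComplexStructure G)
    (η : Fin 3 → ∀ x : G, Tan x →ₗ[ℝ] ℂ) : Prop where
  left_inv : ∀ (i : Fin 3) (a x : G) (v : Tan x), η i (a * x) (dLeft a x v) = η i x v
  type_one_zero : ∀ (i : Fin 3) (x : G) (v : Tan x), η i x (𝒥.J x v) = Complex.I * η i x v
  linearIndependent : ∀ x : G, LinearIndependent ℂ (fun i => η i x)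

/-- There is a left-invariant `(1,0)`-coframe with structure equations
`dω¹ = dω² = 0` and `dω³ = ρ ω¹² + κ ω^{1 1̄} + μ ω^{1 2̄} + D ω^{2 2̄}`. -/
def HasStructureEquations (𝒥 : LeftInvariantComplexStructure G) (ρ κ μ D : ℂ) : Prop :=
  ∃ η : Fin 3 → ∀ x : G, Tan x →ₗ[ℝ] ℂ, IsLeftInvariantCoframe 𝒥 η ∧
    extDer (oneForm (η 0)) = 0 ∧
    extDer (oneForm (η 1)) = 0 ∧
    extDer (oneForm (η 2)) =
      ρ • wedge (oneForm (η 0)) (oneForm (η 1))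
        + κ • wedge (oneForm (η 0)) (conjForm (oneForm (η 0)))
        + μ • wedge (oneForm (η 0)) (conjForm (oneForm (η 1)))
        + D • wedge (oneForm (η 1)) (conjForm (oneForm (η 1)))

/-- The Lie algebra of `G` has a basis whose dual basis `e 0, …, e 5` satisfies the structure
equations `d(e k) = F e k`, where `dα = -α([·,·])`. -/
def LieAlgebraHasEquations (G : Type*) [TopologicalSpace G]
    [ChartedSpace (EuclideanSpace ℝ (Fin 6)) G] [Group G]
    (F : (Fin 6 → Fin 6 → GroupLieAlgebra (𝓡 6) G → GroupLieAlgebra (𝓡 6) G → ℝ) →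
      Fin 6 → GroupLieAlgebra (𝓡 6) G → GroupLieAlgebra (𝓡 6) G → ℝ) : Prop :=
  ∃ b : Module.Basis (Fin 6) ℝ (GroupLieAlgebra (𝓡 6) G),
    ∀ (k : Fin 6) (u v : GroupLieAlgebra (𝓡 6) G),
      -(b.coord k ⁅u, v⁆) =
        F (fun i j u v => b.coord i u * b.coord j v - b.coord i v * b.coord j u) k u v

/-- `𝔥₁ = (0, 0, 0, 0, 0, 0)`. -/
def IsH1 (G : Type*) [TopologicalSpace G] [ChartedSpace (EuclideanSpace ℝ (Fin 6)) G] [Group G] :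
    Prop :=
  LieAlgebraHasEquations G fun _ => ![0, 0, 0, 0, 0, 0]

/-- `𝔥₂ = (0, 0, 0, 0, 12, 34)`. Here `e i j` is the wedge product of the dual basis vectors
numbered `i` and `j`, counted from `0`. -/
def IsH2 (G : Type*) [TopologicalSpace G] [ChartedSpace (EuclideanSpace ℝ (Fin 6)) G] [Group G] :
    Prop :=
  LieAlgebraHasEquations G fun e => ![0, 0, 0, 0, e 0 1, e 2 3]

/-- `𝔥₄ = (0, 0, 0, 0, 12, 14 + 23)`. -/
def IsH4 (G : Type*) [TopologicalSpace G] [ChartedSpace (EuclideanSpace ℝ (Fin 6)) G] [Group G] :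
    Prop :=
  LieAlgebraHasEquations G fun e => ![0, 0, 0, 0, e 0 1, e 0 3 + e 1 2]

/-- `𝔥₅ = (0, 0, 0, 0, 13 + 42, 14 + 23)`. -/
def IsH5 (G : Type*) [TopologicalSpace G] [ChartedSpace (EuclideanSpace ℝ (Fin 6)) G] [Group G] :
    Prop :=
  LieAlgebraHasEquations G fun e => ![0, 0, 0, 0, e 0 2 + e 3 1, e 0 3 + e 1 2]

/-- `𝔥₈ = (0, 0, 0, 0, 0, 12)`. -/
def IsH8 (G : Type*) [TopologicalSpace G] [ChartedSpace (EuclideanSpace ℝ (Fin 6)) G] [Group G] :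
    Prop :=
  LieAlgebraHasEquations G fun e => ![0, 0, 0, 0, 0, e 0 1]

end Structures

end NilSKT

end

/-!
Left-invariant objects on `G` are determined by their values at the identity, so that everything
takes place on the nilpotent Lie algebra `𝔤` of `G` with its complex structure `J`: on
left-invariant forms `extDer` becomes the Chevalley–Eilenberg differential `ceDer`
(`extDer_leftInvForm`), and a Hermitian metric is an inner product `B` on `𝔤` (`isPluriclosed_iff`).
With `ω = B(J·, ·)` and the integrability of `J` one finds `∂∂̄ω = -(i/2) (dc)^{2,2}`, where `c =
-dω(J·, J·, J·)` is `torsion` (`ceDel_ceDelbar_fund`). If `ω` is pluriclosed, `dc(X, JX, Y, JY) = 0`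
for all `X` and `Y`, and this is all that the forward direction uses.

*The pluriclosed condition forces `𝔤` to be two-step nilpotent.* For suitable `X`, the number
`dc(X, JX, Y, JY)` is a sum of squares of brackets and of terms that vanish as soon as the iterated
brackets of `Y` do. Nilpotency provides such vectors `Y`: an ideal that is not contained in a
subspace has an element outside of the subspace all of whose brackets are inside
(`exists_mem_notMem_forall_lie_mem`). In this way the center is `J`-invariant (`J_mem_center`), so
is the second center, by a dimension count (`J_mem_secondCenter`), and finally the second center is
everything (`lie_mem_center`). In dimension `6` the brackets then span a subspace of a central
complex line (`exists_central_line`).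

*Reduction to normal forms.* A `(1,0)`-coframe adapted to this line has `dω¹ = dω² = 0` and
`dω³ = ρ ω¹² + A ω^{1 1̄} + B ω^{1 2̄} + C ω^{2 1̄} + D ω^{2 2̄}`, and the pluriclosed condition is
`|ρ|² + |B|² + |C|² = 2 Re(A D̄)` (`IsHermitianPair.exists_hasCoframe`). A change of `ω¹, ω²` by
`g ∈ GL₂(ℂ)` and a rescaling of `ω³` act on the matrix `[A, B; C, D]` by congruence and on `ρ` by
`det g`, and preserve this equation. Unless it vanishes, the matrix can be made upper triangular
with `A = 1`; its Hermitian part is then positive definite if `B ≠ 0`, and it can be diagonalised.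
What remains is `ρ = 0`, `D ∈ iℝ` or `ρ = 1`, `D = 1/2 + iy` with `y ≥ 0`, and for `4y² ≥ 3` another
change of basis leads to `(ρ, A, B, C) = (1, 1, 1, 0)` and `Re D = 1`, `Im D ≥ 0`
(`HasCoframe.normal_form`). The real Lie algebra is read off from each normal form by an explicit
real coframe.

*Converse.* For each normal form the metric for which the coframe is unitary is pluriclosed: `dc`
is the real part of a `4`-form in `ω¹, ω²` and their conjugates, whose coefficient vanishes by the
equation above (`IsCoframe.dTorsion_eq_zero`).
-/

noncomputable section

namespace NilSKT

open Complex ComplexConjugate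

/-! ### Left-invariant forms and the Lie algebra -/

section Algebraic
variable {L : Type*}

/-- The Chevalley–Eilenberg differential, with the sign conventions and the indexing of
`extDer`. It is defined on all functions of `k + 1` vectors. -/
def ceDer [Bracket L L] {k : ℕ} (φ : (Fin (k + 1) → L) → ℂ) : (Fin (k + 2) → L) → ℂ := fun v =>
  -∑ i : Fin (k + 1), ∑ j ∈ Finset.Ici i, (-1 : ℂ) ^ ((i : ℕ) + (j : ℕ)) *
    φ (Matrix.vecCons ⁅v i.castSucc, v j.succ⁆ (j.removeNth (i.castSucc.removeNth v)))

/-- The component of type `(p, k - p)` of a function of `k` vectors, with respect to an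
endomorphism `J`; the formula is that of `typeComponent`. -/
def typePart (J : L → L) {k : ℕ} (p : ℕ) (φ : (Fin k → L) → ℂ) : (Fin k → L) → ℂ := fun v =>
  ∑ S ∈ Finset.powersetCard p (Finset.univ : Finset (Fin k)), ∑ T : Finset (Fin k),
    (1 / 2 : ℂ) ^ k * (∏ i ∈ T, if i ∈ S then -Complex.I else Complex.I) *
      φ (fun i => if i ∈ T then J (v i) else v i)

end Algebraic

section Group
variable {G : Type*} [TopologicalSpace G] [ChartedSpace (EuclideanSpace ℝ (Fin 6)) G]

theorem mfderiv_apply_eq_zero_of_forall_eq {f : G → ℂ} {c : ℂ} (h : ∀ y, f y = c) (x : G)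
    (v : Tan x) : (show ℂ from mfderiv (𝓡 6) 𝓘(ℝ, ℂ) f x v) = 0 := by
  obtain rfl : f = fun _ => c := funext h
  rw [mfderiv_const]; rfl

variable [Group G]

/-- The differential at `x` of the left translation by `a`, all tangent spaces being identified
with the model space. This hides the dependence of the types on base points such as `x⁻¹ * x`. -/
def transl (a x : G) : EuclideanSpace ℝ (Fin 6) →L[ℝ] EuclideanSpace ℝ (Fin 6) :=
  mfderiv (𝓡 6) (𝓡 6) (fun y : G => a * y) x

theorem transl_one (x : G) (v : EuclideanSpace ℝ (Fin 6)) : transl 1 x v = v := by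
  have h2 : (fun y : G => 1 * y) = id := by ext y; simp
  unfold transl
  rw [h2, mfderiv_id]; rfl

theorem toIdentity_one (v : Tan (1 : G)) : toIdentity 1 v = v := by
  change transl 1⁻¹ 1 v = v
  rw [inv_one]
  exact transl_one 1 _

/-- The left-invariant form with value `φ` at the identity. -/
def leftInvForm {k : ℕ} (φ : (Fin k → GroupLieAlgebra (𝓡 6) G) → ℂ) : CForm G k := fun x v =>
  φ fun i => toIdentity x (v i)

theorem leftInvForm_injective {k : ℕ} :
    Function.Injective (leftInvForm (G := G) (k := k)) := by
  intro φ ψ h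
  ext v
  have := congrFun (congrFun h 1) v
  simpa only [leftInvForm, toIdentity_one] using this

theorem leftInvForm_eq_zero_iff {k : ℕ} {φ : (Fin k → GroupLieAlgebra (𝓡 6) G) → ℂ} :
    leftInvForm φ = 0 ↔ φ = 0 :=
  ⟨fun h => leftInvForm_injective h, fun h => by subst h; rfl⟩

theorem sum_leftInvForm {ι : Type*} {k : ℕ} (s : Finset ι)
    (φ : ι → (Fin k → GroupLieAlgebra (𝓡 6) G) → ℂ) :
    ∑ i ∈ s, leftInvForm (φ i) = leftInvForm (∑ i ∈ s, φ i) := by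
  ext x v
  simp [leftInvForm, Finset.sum_apply]

variable [LieGroup (𝓡 6) ∞ G]

theorem mdifferentiableAt_mul_left (a x : G) :
    MDifferentiableAt (𝓡 6) (𝓡 6) (fun y : G => a * y) x :=
  (contMDiff_mul_left (I := 𝓡 6) (n := ∞) (a := a)).contMDiffAt.mdifferentiableAt (by simp)

theorem transl_transl (a b x : G) (v : EuclideanSpace ℝ (Fin 6)) :
    transl a (b * x) (transl b x v) = transl (a * b) x v := by
  have h := mfderiv_comp (I := 𝓡 6) (I' := 𝓡 6) (I'' := 𝓡 6) (g := fun y : G => a * y)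
    (f := fun y : G => b * y) x
    (mdifferentiableAt_mul_left a (b * x)) (mdifferentiableAt_mul_left b x)
  have h2 : (fun y : G => a * b * y) = (fun y : G => a * y) ∘ (fun y : G => b * y) := by
    ext y; simp [mul_assoc]
  unfold transl
  rw [h2, h]; rfl

theorem toIdentity_mulInvariantVectorField (x : G) (u : GroupLieAlgebra (𝓡 6) G) :
    toIdentity x (mulInvariantVectorField u x) = u := by
  change transl x⁻¹ x (transl x 1 u) = u
  have := transl_transl x⁻¹ x 1 u
  rw [mul_one, inv_mul_cancel] at this
  exact this.trans (transl_one 1 _)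

theorem mulInvariantVectorField_toIdentity (x : G) (v : Tan x) :
    mulInvariantVectorField (I := 𝓡 6) (toIdentity x v) x = v := by
  change transl x 1 (transl x⁻¹ x v) = v
  have := transl_transl x x⁻¹ x v
  rw [inv_mul_cancel, mul_inv_cancel] at this
  exact this.trans (transl_one x _)

theorem toIdentity_dLeft (a x : G) (v : Tan x) :
    toIdentity (a * x) (dLeft a x v) = toIdentity x v := by
  change transl (a * x)⁻¹ (a * x) (transl a x v) = transl x⁻¹ x v
  have := transl_transl (a * x)⁻¹ a x v
  rwa [mul_inv_rev, inv_mul_cancel_right, ← mul_inv_rev] at this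

/-- The left translation to the identity, as a linear equivalence. -/
def toIdentityEquiv (x : G) : Tan x ≃ₗ[ℝ] GroupLieAlgebra (𝓡 6) G where
  toFun := toIdentity x
  invFun := fun u => mulInvariantVectorField u x
  map_add' u v := map_add (transl x⁻¹ x) u v
  map_smul' c v := map_smul (transl x⁻¹ x) c v
  left_inv v := mulInvariantVectorField_toIdentity x v
  right_inv u := toIdentity_mulInvariantVectorField x u

theorem mlieBracket_leftInvExt (x : G) (u v : Tan x) :
    toIdentity x (VectorField.mlieBracket (𝓡 6) (leftInvExt x u) (leftInvExt x v) x) =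
      ⁅toIdentity x u, toIdentity x v⁆ := by
  unfold leftInvExt
  rw [← mulInvariantVector_mlieBracket, ← GroupLieAlgebra.bracket_def,
    toIdentity_mulInvariantVectorField]

theorem extDer_leftInvForm {k : ℕ} (φ : (Fin (k + 1) → GroupLieAlgebra (𝓡 6) G) → ℂ) :
    extDer (leftInvForm φ) = leftInvForm (ceDer φ) := by
  ext x v
  have hconst : ∀ (i : Fin (k + 2)) (y : G), leftInvForm φ y
      (fun m => leftInvExt x (i.removeNth v m) y) =
      φ (fun m => toIdentity x (i.removeNth v m)) := by
    intro i y
    simp only [leftInvForm, leftInvExt, toIdentity_mulInvariantVectorField]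
  refine (congrArg₂ (· - ·) (Finset.sum_eq_zero fun i _ => ?_)
    (Finset.sum_congr rfl fun i _ => Finset.sum_congr rfl fun j _ => ?_)).trans (zero_sub _)
  · rw [mfderiv_apply_eq_zero_of_forall_eq (hconst i) x, mul_zero]
  · refine congrArg _ (congrArg φ ?_)
    ext1 m
    refine Fin.cases ?_ (fun m => ?_) m
    · exact mlieBracket_leftInvExt x _ _
    · rfl

variable (𝒥 : LeftInvariantComplexStructure G)

/-- The complex structure on the Lie algebra: the value at the identity. -/
def LeftInvariantComplexStructure.atOne : GroupLieAlgebra (𝓡 6) G →ₗ[ℝ] GroupLieAlgebra (𝓡 6) G :=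
  (𝒥.J 1).toLinearMap

theorem J_mulInvariantVectorField (x : G) (u : GroupLieAlgebra (𝓡 6) G) :
    𝒥.J x (mulInvariantVectorField u x) = mulInvariantVectorField (𝒥.atOne u) x := by
  have h := 𝒥.left_inv x 1 u
  -- `x * 1` and `x` are not definitionally equal, but all tangent spaces are the model space
  have key : ∀ z : G, z = x → (𝒥.J z : EuclideanSpace ℝ (Fin 6) →L[ℝ] EuclideanSpace ℝ (Fin 6))
      = 𝒥.J x := by
    rintro _ rfl; rfl
  have h1 := congrArg (fun f => f (transl x 1 u)) (key (x * 1) (mul_one x))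
  exact h1.symm.trans h

theorem toIdentity_J (x : G) (v : Tan x) :
    toIdentity x (𝒥.J x v) = 𝒥.atOne (toIdentity x v) := by
  conv_lhs => rw [← mulInvariantVectorField_toIdentity x v, J_mulInvariantVectorField,
    toIdentity_mulInvariantVectorField]

theorem atOne_atOne (u : GroupLieAlgebra (𝓡 6) G) : 𝒥.atOne (𝒥.atOne u) = -u :=
  𝒥.sq_eq_neg 1 u

theorem atOne_nijenhuis (u v : GroupLieAlgebra (𝓡 6) G) :
    ⁅𝒥.atOne u, 𝒥.atOne v⁆ - 𝒥.atOne ⁅𝒥.atOne u, v⁆ - 𝒥.atOne ⁅u, 𝒥.atOne v⁆ - ⁅u, v⁆ = 0 := by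
  have hs : ∀ w : GroupLieAlgebra (𝓡 6) G, ContMDiff (𝓡 6) (𝓡 6).tangent 1
      (fun x => (⟨x, mulInvariantVectorField w x⟩ : TangentBundle (𝓡 6) G)) := fun w =>
    (contMDiff_mulInvariantVectorField w).of_le
      (le_trans (by norm_cast) (le_minSmoothness (𝕜 := ℝ)))
  have h := 𝒥.nijenhuis (mulInvariantVectorField u) (mulInvariantVectorField v) (hs u) (hs v) 1
  simp only [J_mulInvariantVectorField] at h
  exact h

theorem typeComponent_leftInvForm {k : ℕ} (p : ℕ)
    (φ : (Fin k → GroupLieAlgebra (𝓡 6) G) → ℂ) :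
    typeComponent 𝒥 p (leftInvForm φ) = leftInvForm (typePart 𝒥.atOne p φ) := by
  ext x v
  simp only [typeComponent, leftInvForm, typePart, apply_ite (toIdentity x), toIdentity_J]

end Group

/-! ### Low-degree formulas for the differential and the type decomposition -/

section

variable {L : Type*}

theorem ceDer_two [Bracket L L] (f : L → L → ℂ) (v : Fin 3 → L) :
    ceDer (fun v : Fin 2 → L => f (v 0) (v 1)) v =
      -f ⁅v 0, v 1⁆ (v 2) + f ⁅v 0, v 2⁆ (v 1) - f ⁅v 1, v 2⁆ (v 0) := by
  have h0 : Finset.Ici (0 : Fin 2) = {0, 1} := by decide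
  have h1 : Finset.Ici (1 : Fin 2) = {1} := by decide
  simp [ceDer, Fin.sum_univ_two, h0, h1, Fin.removeNth, Fin.succAbove]
  ring

theorem ceDer_three [Bracket L L] (f : L → L → L → ℂ) (v : Fin 4 → L) :
    ceDer (fun v : Fin 3 → L => f (v 0) (v 1) (v 2)) v =
      -f ⁅v 0, v 1⁆ (v 2) (v 3) + f ⁅v 0, v 2⁆ (v 1) (v 3) - f ⁅v 0, v 3⁆ (v 1) (v 2)
        - f ⁅v 1, v 2⁆ (v 0) (v 3) + f ⁅v 1, v 3⁆ (v 0) (v 2) - f ⁅v 2, v 3⁆ (v 0) (v 1) := by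
  have h0 : Finset.Ici (0 : Fin 3) = {0, 1, 2} := by decide
  have h1 : Finset.Ici (1 : Fin 3) = {1, 2} := by decide
  have h2 : Finset.Ici (2 : Fin 3) = {2} := by decide
  simp [ceDer, Fin.sum_univ_three, h0, h1, h2, Fin.removeNth, Fin.succAbove]
  ring

/-- The sum over the sets `S` in the definition of `typePart`. -/
def typeCoeff (k p : ℕ) (T : Finset (Fin k)) : ℂ :=
  ∑ S ∈ Finset.powersetCard p (Finset.univ : Finset (Fin k)),
    ∏ i ∈ T, if i ∈ S then -Complex.I else Complex.I

theorem typePart_eq (J : L → L) {k : ℕ} (p : ℕ) (φ : (Fin k → L) → ℂ) (v : Fin k → L) :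
    typePart J p φ v = (1 / 2 : ℂ) ^ k *
      ∑ T : Finset (Fin k), typeCoeff k p T * φ (fun i => if i ∈ T then J (v i) else v i) := by
  rw [typePart, Finset.sum_comm, Finset.mul_sum]
  refine Finset.sum_congr rfl fun T _ => ?_
  rw [typeCoeff, Finset.sum_mul, Finset.mul_sum]
  refine Finset.sum_congr rfl fun S _ => ?_
  ring

theorem typePart_two (J : L → L) (f : L → L → ℂ) (v : Fin 2 → L) :
    (typePart J 0 (fun v : Fin 2 → L => f (v 0) (v 1)) v =
      1 / 4 * (f (v 0) (v 1) + Complex.I * (f (J (v 0)) (v 1) + f (v 0) (J (v 1)))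
        - f (J (v 0)) (J (v 1)))) ∧
    (typePart J 1 (fun v : Fin 2 → L => f (v 0) (v 1)) v =
      1 / 2 * (f (v 0) (v 1) + f (J (v 0)) (J (v 1)))) ∧
    (typePart J 2 (fun v : Fin 2 → L => f (v 0) (v 1)) v =
      1 / 4 * (f (v 0) (v 1) - Complex.I * (f (J (v 0)) (v 1) + f (v 0) (J (v 1)))
        - f (J (v 0)) (J (v 1)))) := by
  have hu : (Finset.univ : Finset (Finset (Fin 2))) = {∅, {0}, {1}, {0, 1}} := by decide
  have h1 : Finset.powersetCard 1 (Finset.univ : Finset (Fin 2)) = {{0}, {1}} := by decide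
  have h2 : Finset.powersetCard 2 (Finset.univ : Finset (Fin 2)) = {{0, 1}} := by decide
  refine ⟨?_, ?_, ?_⟩ <;> rw [typePart_eq, hu] <;>
    (iterate 3 rw [Finset.sum_insert (by decide)]) <;> simp [typeCoeff, h1, h2] <;> ring_nf

theorem typePart_three (J : L → L) (f : L → L → L → ℂ) {s t w : ℂ} (v : Fin 3 → L)
    (hs : f (J (v 0)) (v 1) (v 2) + f (v 0) (J (v 1)) (v 2) + f (v 0) (v 1) (J (v 2)) = s)
    (ht : f (J (v 0)) (J (v 1)) (v 2) + f (J (v 0)) (v 1) (J (v 2))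
       + f (v 0) (J (v 1)) (J (v 2)) = t)
    (hw : f (J (v 0)) (J (v 1)) (J (v 2)) = w) :
    (typePart J 0 (fun v : Fin 3 → L => f (v 0) (v 1) (v 2)) v =
      1 / 8 * (f (v 0) (v 1) (v 2) + Complex.I * s - t - Complex.I * w)) ∧
    (typePart J 1 (fun v : Fin 3 → L => f (v 0) (v 1) (v 2)) v =
      1 / 8 * (3 * f (v 0) (v 1) (v 2) + Complex.I * s + t + 3 * Complex.I * w)) ∧
    (typePart J 2 (fun v : Fin 3 → L => f (v 0) (v 1) (v 2)) v =
      1 / 8 * (3 * f (v 0) (v 1) (v 2) - Complex.I * s + t - 3 * Complex.I * w)) ∧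
    (typePart J 3 (fun v : Fin 3 → L => f (v 0) (v 1) (v 2)) v =
      1 / 8 * (f (v 0) (v 1) (v 2) - Complex.I * s - t + Complex.I * w)) := by
  have hu : (Finset.univ : Finset (Finset (Fin 3))) =
    {∅, {0}, {1}, {2}, {0, 1}, {0, 2}, {1, 2}, {0, 1, 2}} := by decide
  have h1 : Finset.powersetCard 1 (Finset.univ : Finset (Fin 3)) = {{0}, {1}, {2}} := by decide
  have h2 : Finset.powersetCard 2 (Finset.univ : Finset (Fin 3)) =
    {{0, 1}, {0, 2}, {1, 2}} := by decide
  have h2' : ∀ g : Finset (Fin 3) → ℂ,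
      ∑ S ∈ Finset.powersetCard 2 Finset.univ, g S = g {0, 1} + (g {0, 2} + g {1, 2}) := by
    intro g
    rw [h2, Finset.sum_insert (by decide), Finset.sum_insert (by decide), Finset.sum_singleton]
  have h3 : Finset.powersetCard 3 (Finset.univ : Finset (Fin 3)) = {{0, 1, 2}} := by decide
  subst hs ht hw
  refine ⟨?_, ?_, ?_, ?_⟩ <;> rw [typePart_eq, hu] <;>
    (iterate 7 rw [Finset.sum_insert (by decide)]) <;> simp [typeCoeff, h1, h2', h3] <;> ring_nf

theorem typePart_four (J : L → L) (f : L → L → L → L → ℂ) (v : Fin 4 → L) :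
    typePart J 2 (fun v : Fin 4 → L => f (v 0) (v 1) (v 2) (v 3)) v =
     1 / 8 * (3 * f (v 0) (v 1) (v 2) (v 3) + f (J (v 0)) (J (v 1)) (v 2) (v 3)
      + f (J (v 0)) (v 1) (J (v 2)) (v 3) + f (J (v 0)) (v 1) (v 2) (J (v 3))
      + f (v 0) (J (v 1)) (J (v 2)) (v 3) + f (v 0) (J (v 1)) (v 2) (J (v 3))
      + f (v 0) (v 1) (J (v 2)) (J (v 3)) + 3 * f (J (v 0)) (J (v 1)) (J (v 2)) (J (v 3))) := by
  have hu : (Finset.univ : Finset (Finset (Fin 4))) =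
    {∅, {0}, {1}, {2}, {3}, {0, 1}, {0, 2}, {0, 3}, {1, 2}, {1, 3}, {2, 3}, {0, 1, 2},
      {0, 1, 3}, {0, 2, 3}, {1, 2, 3}, {0, 1, 2, 3}} := by decide
  have hp : Finset.powersetCard 2 (Finset.univ : Finset (Fin 4)) =
    {{0, 1}, {0, 2}, {0, 3}, {1, 2}, {1, 3}, {2, 3}} := by decide
  have hp' : ∀ g : Finset (Fin 4) → ℂ, ∑ S ∈ Finset.powersetCard 2 Finset.univ, g S =
      g {0, 1} + (g {0, 2} + (g {0, 3} + (g {1, 2} + (g {1, 3} + g {2, 3})))) := by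
    intro g
    rw [hp]
    iterate 5 rw [Finset.sum_insert (by decide)]
    rw [Finset.sum_singleton]
  rw [typePart_eq, hu]
  iterate 15 rw [Finset.sum_insert (by decide)]
  simp [typeCoeff, hp']
  ring_nf

end

/-! ### The torsion form and the pluriclosed condition -/

section

variable {L : Type*} [LieRing L] [LieAlgebra ℝ L]

/-- The operator `∂` on the cochains of a Lie algebra with endomorphism `J`, as in `del`. -/
def ceDel (J : L → L) {k : ℕ} (φ : (Fin (k + 1) → L) → ℂ) : (Fin (k + 2) → L) → ℂ :=
  ∑ p ∈ Finset.range (k + 2), typePart J (p + 1) (ceDer (typePart J p φ))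

/-- The operator `∂̄` on the cochains of a Lie algebra with endomorphism `J`, as in `delbar`. -/
def ceDelbar (J : L → L) {k : ℕ} (φ : (Fin (k + 1) → L) → ℂ) : (Fin (k + 2) → L) → ℂ :=
  ∑ p ∈ Finset.range (k + 2), typePart J p (ceDer (typePart J p φ))

/-- A complex structure `J` with vanishing Nijenhuis tensor on a real Lie algebra, together with a
Hermitian inner product `B`. -/
structure IsHermitianPair (J : L →ₗ[ℝ] L) (B : L →ₗ[ℝ] L →ₗ[ℝ] ℝ) : Prop where
  sq : ∀ u, J (J u) = -u
  nijenhuis : ∀ u v, ⁅J u, J v⁆ = J ⁅J u, v⁆ + J ⁅u, J v⁆ + ⁅u, v⁆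
  symm : ∀ u v, B u v = B v u
  pos : ∀ v, v ≠ 0 → 0 < B v v
  hermitian : ∀ u v, B (J u) (J v) = B u v

/-- The torsion `3`-form of the Bismut connection, up to sign: with `ω = B(J·,·)`, it is
`-dω(J·,J·,J·)`. -/
def torsion (J : L →ₗ[ℝ] L) (B : L →ₗ[ℝ] L →ₗ[ℝ] ℝ) (a b c : L) : ℝ :=
  B ⁅J a, J b⁆ c + B ⁅J b, J c⁆ a + B ⁅J c, J a⁆ b

/-- The exterior derivative of `torsion`. -/
def dTorsion (J : L →ₗ[ℝ] L) (B : L →ₗ[ℝ] L →ₗ[ℝ] ℝ) (a b c d : L) : ℝ :=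
  -torsion J B ⁅a, b⁆ c d + torsion J B ⁅a, c⁆ b d - torsion J B ⁅a, d⁆ b c
    - torsion J B ⁅b, c⁆ a d + torsion J B ⁅b, d⁆ a c - torsion J B ⁅c, d⁆ a b

/-- The exterior derivative of `ω = B(J·,·)`. -/
def dFund (J : L →ₗ[ℝ] L) (B : L →ₗ[ℝ] L →ₗ[ℝ] ℝ) (a b c : L) : ℝ :=
  -B (J ⁅a, b⁆) c + B (J ⁅a, c⁆) b - B (J ⁅b, c⁆) a

namespace IsHermitianPair

variable {J : L →ₗ[ℝ] L} {B : L →ₗ[ℝ] L →ₗ[ℝ] ℝ} (h : IsHermitianPair J B)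
include h

theorem B_J_left (u v : L) : B (J u) v = -B u (J v) := by
  rw [← h.hermitian u (J v), h.sq, map_neg, neg_neg]

theorem dFund_J_J_J (a b c : L) : dFund J B (J a) (J b) (J c) = -torsion J B a b c := by
  simp only [dFund, torsion, h.hermitian]
  rw [← lie_skew (J a) (J c), map_neg, LinearMap.neg_apply]
  ring

theorem dFund_eq_add (a b c : L) : dFund J B (J a) (J b) c + dFund J B (J a) b (J c)
    + dFund J B a (J b) (J c) = dFund J B a b c := by
  simp only [dFund, h.B_J_left, h.sq, h.nijenhuis, map_add, map_neg, LinearMap.add_apply,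
    LinearMap.neg_apply]
  ring

theorem dFund_J_add (a b c : L) : dFund J B (J a) b c + dFund J B a (J b) c
    + dFund J B a b (J c) = -torsion J B a b c := by
  have := h.dFund_eq_add (J a) (J b) (J c)
  have t := h.dFund_J_J_J a b c
  simp only [h.sq] at this
  simp only [dFund, map_neg, neg_lie, lie_neg, LinearMap.neg_apply] at this t ⊢
  linarith

theorem torsion_J_J_J (a b c : L) : torsion J B (J a) (J b) (J c) = dFund J B a b c := by
  rw [← neg_neg (torsion J B (J a) (J b) (J c)), ← h.dFund_J_J_J]
  simp only [h.sq]
  simp only [dFund, map_neg, neg_lie, lie_neg, LinearMap.neg_apply]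
  ring

theorem torsion_J_J_add (a b c : L) : torsion J B (J a) (J b) c + torsion J B (J a) b (J c)
    + torsion J B a (J b) (J c) = torsion J B a b c := by
  have h1 := h.dFund_J_J_J (J a) (J b) c
  have h2 := h.dFund_J_J_J (J a) b (J c)
  have h3 := h.dFund_J_J_J a (J b) (J c)
  have h4 := h.dFund_J_add a b c
  simp only [h.sq] at h1 h2 h3
  simp only [dFund, map_neg, neg_lie, lie_neg, LinearMap.neg_apply] at h1 h2 h3 h4
  linarith

theorem torsion_J_add (a b c : L) : torsion J B (J a) b c + torsion J B a (J b) c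
    + torsion J B a b (J c) = dFund J B a b c := by
  have h1 := h.dFund_J_J_J (J a) b c
  have h2 := h.dFund_J_J_J a (J b) c
  have h3 := h.dFund_J_J_J a b (J c)
  have h4 := h.dFund_eq_add a b c
  simp only [h.sq] at h1 h2 h3
  simp only [dFund, map_neg, neg_lie, lie_neg, LinearMap.neg_apply] at h1 h2 h3 h4 ⊢
  linarith

/-- The identity `d(dω) = 0`. -/
theorem ceDer_dFund (a b c d : L) :
    -dFund J B ⁅a, b⁆ c d + dFund J B ⁅a, c⁆ b d - dFund J B ⁅a, d⁆ b c
    - dFund J B ⁅b, c⁆ a d + dFund J B ⁅b, d⁆ a c - dFund J B ⁅c, d⁆ a b = 0 := by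
  have hsk : ∀ u v, B (J u) v = -B (J v) u := fun u v => by rw [h.B_J_left, h.symm]
  have hj : ∀ x y z w, B (J ⁅⁅x, y⁆, z⁆) w =
      B (J ⁅⁅x, z⁆, y⁆) w - B (J ⁅⁅y, z⁆, x⁆) w := by
    intro x y z w
    rw [lie_lie x y z, ← lie_skew x ⁅y, z⁆, ← lie_skew y ⁅x, z⁆]
    simp only [map_sub, map_neg, LinearMap.sub_apply, LinearMap.neg_apply]
    ring
  simp only [dFund]
  linear_combination hsk ⁅c, d⁆ ⁅a, b⁆ - hsk ⁅b, d⁆ ⁅a, c⁆ + hsk ⁅b, c⁆ ⁅a, d⁆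
    + hj a b c d - hj a b d c + hj a c d b - hj b c d a

theorem ceDelbar_fund : ceDelbar J (fun v : Fin 2 → L => ((B (J (v 0)) (v 1) : ℝ) : ℂ)) =
    fun v : Fin 3 → L => 1 / 2 * ((dFund J B (v 0) (v 1) (v 2) : ℝ) -
      Complex.I * (torsion J B (v 0) (v 1) (v 2) : ℝ)) := by
  have hc : ∀ v : Fin 2 → L, (B (J (J (v 0))) (J (v 1)) : ℝ) = B (J (v 0)) (v 1) :=
    fun v => h.hermitian _ _
  have hd : ∀ v : Fin 2 → L, (B (J (J (v 0))) (v 1) : ℝ) = - B (J (v 0)) (J (v 1)) :=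
    fun v => h.B_J_left _ _
  have h0 : typePart J 0 (fun v : Fin 2 → L => ((B (J (v 0)) (v 1) : ℝ) : ℂ)) = fun _ => 0 := by
    funext v
    rw [(typePart_two J (fun a b => ((B (J a) b : ℝ) : ℂ)) v).1, hc, hd]; push_cast; ring
  have h1 : typePart J 1 (fun v : Fin 2 → L => ((B (J (v 0)) (v 1) : ℝ) : ℂ)) =
      fun v : Fin 2 → L => ((B (J (v 0)) (v 1) : ℝ) : ℂ) := by
    funext v
    rw [(typePart_two J (fun a b => ((B (J a) b : ℝ) : ℂ)) v).2.1, hc]; ring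
  have h2 : typePart J 2 (fun v : Fin 2 → L => ((B (J (v 0)) (v 1) : ℝ) : ℂ)) = fun _ => 0 := by
    funext v
    rw [(typePart_two J (fun a b => ((B (J a) b : ℝ) : ℂ)) v).2.2, hc, hd]; push_cast; ring
  have hz : ceDer (fun _ : Fin 2 → L => (0 : ℂ)) = fun _ => 0 := by funext v; simp [ceDer]
  have hz' : ∀ p, typePart J p (fun _ : Fin 3 → L => (0 : ℂ)) = 0 := by
    intro p; funext v; simp [typePart]
  have h3 : ceDer (fun v : Fin 2 → L => ((B (J (v 0)) (v 1) : ℝ) : ℂ)) =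
      fun v : Fin 3 → L => ((dFund J B (v 0) (v 1) (v 2) : ℝ) : ℂ) := by
    funext v
    rw [ceDer_two (fun a b => ((B (J a) b : ℝ) : ℂ)) v]; simp [dFund]
  rw [ceDelbar, Finset.sum_range_succ, Finset.sum_range_succ, Finset.sum_range_one, h0, h1, h2,
    hz, hz', hz', h3, zero_add, add_zero]
  funext v
  have e1 : (_ : ℂ) = _ := congrArg Complex.ofReal (h.dFund_J_add (v 0) (v 1) (v 2))
  have e2 : (_ : ℂ) = _ := congrArg Complex.ofReal (h.dFund_eq_add (v 0) (v 1) (v 2))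
  have e3 : (_ : ℂ) = _ := congrArg Complex.ofReal (h.dFund_J_J_J (v 0) (v 1) (v 2))
  push_cast at e1 e2
  rw [(typePart_three J (fun a b c => ((dFund J B a b c : ℝ) : ℂ)) v e1 e2 e3).2.1]
  push_cast; ring

theorem ceDel_ceDelbar_fund :
    ceDel J (ceDelbar J (fun v : Fin 2 → L => ((B (J (v 0)) (v 1) : ℝ) : ℂ))) =
    typePart J 2 (fun v : Fin 4 → L =>
      -(Complex.I / 2) * (dTorsion J B (v 0) (v 1) (v 2) (v 3) : ℝ)) := by
  set f : L → L → L → ℂ := fun a b c => 1 / 2 * ((dFund J B a b c : ℝ) -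
      Complex.I * (torsion J B a b c : ℝ)) with hf
  have hfund : ceDelbar J (fun v : Fin 2 → L => ((B (J (v 0)) (v 1) : ℝ) : ℂ)) =
    fun v : Fin 3 → L => f (v 0) (v 1) (v 2) := h.ceDelbar_fund
  have hs : ∀ a b c, f (J a) b c + f a (J b) c + f a b (J c) = -Complex.I * f a b c := by
    intro a b c
    have e1 : (_ : ℂ) = _ := congrArg Complex.ofReal (h.dFund_J_add a b c)
    have e2 : (_ : ℂ) = _ := congrArg Complex.ofReal (h.torsion_J_add a b c)
    push_cast at e1 e2
    simp only [hf]
    linear_combination 1 / 2 * e1 - Complex.I / 2 * e2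
      - (1 / 2) * (torsion J B a b c : ℂ) * Complex.I_sq
  have ht : ∀ a b c, f (J a) (J b) c + f (J a) b (J c) + f a (J b) (J c) = f a b c := by
    intro a b c
    have e1 : (_ : ℂ) = _ := congrArg Complex.ofReal (h.dFund_eq_add a b c)
    have e2 : (_ : ℂ) = _ := congrArg Complex.ofReal (h.torsion_J_J_add a b c)
    push_cast at e1 e2
    simp only [hf]
    linear_combination 1 / 2 * e1 - Complex.I / 2 * e2
  have hw : ∀ a b c, f (J a) (J b) (J c) = -Complex.I * f a b c := by
    intro a b c
    simp only [hf, h.dFund_J_J_J, h.torsion_J_J_J]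
    push_cast
    linear_combination - (1 / 2) * (torsion J B a b c : ℂ) * Complex.I_sq
  have key := fun v : Fin 3 → L => typePart_three J f v (hs _ _ _) (ht _ _ _) (hw _ _ _)
  have h0 : typePart J 0 (fun v : Fin 3 → L => f (v 0) (v 1) (v 2)) = fun _ => 0 := by
    funext v; rw [(key v).1]; ring
  have h1 : typePart J 1 (fun v : Fin 3 → L => f (v 0) (v 1) (v 2)) =
      fun v : Fin 3 → L => f (v 0) (v 1) (v 2) := by
    funext v; rw [(key v).2.1]; ring_nf; simp only [Complex.I_sq]; ring
  have h2 : typePart J 2 (fun v : Fin 3 → L => f (v 0) (v 1) (v 2)) = fun _ => 0 := by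
    funext v; rw [(key v).2.2.1]; ring_nf; simp only [Complex.I_sq]; ring
  have h3 : typePart J 3 (fun v : Fin 3 → L => f (v 0) (v 1) (v 2)) = fun _ => 0 := by
    funext v; rw [(key v).2.2.2]; ring
  have hz : ceDer (fun _ : Fin 3 → L => (0 : ℂ)) = fun _ => 0 := by funext v; simp [ceDer]
  have hz' : ∀ p, typePart J p (fun _ : Fin 4 → L => (0 : ℂ)) = 0 := by
    intro p; funext v; simp [typePart]
  have h4 : ceDer (fun v : Fin 3 → L => f (v 0) (v 1) (v 2)) =
      fun v : Fin 4 → L => -(Complex.I / 2) * (dTorsion J B (v 0) (v 1) (v 2) (v 3) : ℝ) := by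
    funext v
    have e : (_ : ℂ) = _ := congrArg Complex.ofReal (h.ceDer_dFund (v 0) (v 1) (v 2) (v 3))
    rw [ceDer_three f v]
    push_cast [dTorsion] at e ⊢
    simp only [hf]
    linear_combination 1 / 2 * e
  rw [hfund, ceDel]
  iterate 3 rw [Finset.sum_range_succ]
  rw [Finset.sum_range_one, h0, h1, h2, h3, hz, hz', hz', hz', h4, zero_add, add_zero, add_zero]

/-- A pluriclosed metric satisfies `d(torsion) = 0` on the complex `2`-planes. Only the vectors
`(X, JX, Y, JY)` are considered, on which a real `4`-form is equal to its `(2, 2)` component. -/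
theorem dTorsion_eq_zero_of_pluriclosed
    (hp : ceDel J (ceDelbar J (fun v : Fin 2 → L => ((B (J (v 0)) (v 1) : ℝ) : ℂ))) = 0)
    (X Y : L) : dTorsion J B X (J X) Y (J Y) = 0 := by
  rw [h.ceDel_ceDelbar_fund] at hp
  have e := congrFun hp ![X, J X, Y, J Y]
  rw [typePart_four J (fun a b c d => -(Complex.I / 2) * (dTorsion J B a b c d : ℝ))] at e
  have tn : ∀ a b c, torsion J B (-a) b c = -torsion J B a b c := by
    intro a b c
    simp only [torsion, map_neg, neg_lie, LinearMap.neg_apply, lie_neg]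
    ring
  have ts : ∀ a b c, torsion J B a c b = -torsion J B a b c := by
    intro a b c
    simp only [torsion]
    rw [← lie_skew (J a) (J b), ← lie_skew (J c) (J a), ← lie_skew (J b) (J c)]
    simp only [map_neg, LinearMap.neg_apply]
    ring
  have e01 : ∀ a b c d, dTorsion J B b a c d = -dTorsion J B a b c d := by
    intro a b c d
    simp only [dTorsion]
    rw [← lie_skew a b, tn, ts _ a b]
    ring
  have e23 : ∀ a b c d, dTorsion J B a b d c = -dTorsion J B a b c d := by
    intro a b c d
    simp only [dTorsion]
    rw [← lie_skew c d, tn, ts _ c d]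
    ring
  have n1 : ∀ a b c d, dTorsion J B a (-b) c d = -dTorsion J B a b c d := by
    intro a b c d
    simp only [dTorsion, torsion, map_neg, neg_lie, LinearMap.neg_apply, lie_neg]
    ring
  have n3 : ∀ a b c d, dTorsion J B a b c (-d) = -dTorsion J B a b c d := by
    intro a b c d
    simp only [dTorsion, torsion, map_neg, neg_lie, LinearMap.neg_apply, lie_neg]
    ring
  have z01 : ∀ a c d, dTorsion J B a a c d = 0 := fun a c d => by linarith [e01 a a c d]
  have z23 : ∀ a b c, dTorsion J B a b c c = 0 := fun a b c => by linarith [e23 a b c c]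
  simp [h.sq, n1, n3, z01, e01 X (J X), e23 _ _ Y (J Y)] at e
  have : (dTorsion J B X (J X) Y (J Y) : ℂ) = 0 := by
    linear_combination (Complex.I / 4) * e +
      (dTorsion J B X (J X) Y (J Y) : ℂ) * Complex.I_sq
  exact_mod_cast this

end IsHermitianPair

end

/-! ### Nilpotent Lie algebras with complex structure -/

section

variable {L : Type*} [LieRing L] [LieAlgebra ℝ L]

/-- In a nilpotent Lie algebra, an ideal `W` that is not contained in a subspace `I` contains a
vector outside of `I` whose brackets all lie in `I`: otherwise iterated brackets of elements
of `W` would never reach `I`, let alone `0`. -/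
theorem exists_mem_notMem_forall_lie_mem [LieRing.IsNilpotent L] (W I : Submodule ℝ L)
    (hW : ∀ x : L, ∀ w ∈ W, ⁅x, w⁆ ∈ W) (hWI : ¬ W ≤ I) :
    ∃ w ∈ W, w ∉ I ∧ ∀ x : L, ⁅x, w⁆ ∈ I := by
  by_contra! H
  obtain ⟨k, hk⟩ := LieModule.IsNilpotent.nilpotent ℤ L L
  have step : ∀ n, ∃ w ∈ W, w ∉ I ∧ w ∈ LieModule.lowerCentralSeries ℤ L L n := by
    intro n
    induction n with
    | zero =>
      obtain ⟨w, hw, hwI⟩ := Set.not_subset.mp hWI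
      exact ⟨w, hw, hwI, by simp⟩
    | succ n ih =>
      obtain ⟨w, hw, hwI, hwn⟩ := ih
      obtain ⟨x, hx⟩ := H w hw hwI
      refine ⟨⁅x, w⁆, hW x w hw, hx, ?_⟩
      rw [LieModule.lowerCentralSeries_succ]
      exact LieSubmodule.lie_mem_lie (LieSubmodule.mem_top x) hwn
  obtain ⟨w, -, hwI, hw⟩ := step k
  rw [hk, LieSubmodule.mem_bot] at hw
  exact hwI (hw ▸ I.zero_mem)

theorem exists_notMem_forall_lie_mem [LieRing.IsNilpotent L] (I : Submodule ℝ L)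
    (hI : I ≠ ⊤) : ∃ w, w ∉ I ∧ ∀ x : L, ⁅x, w⁆ ∈ I := by
  obtain ⟨w, -, h⟩ := exists_mem_notMem_forall_lie_mem ⊤ I (fun _ _ _ => trivial)
    (fun h => hI (top_le_iff.mp h))
  exact ⟨w, h⟩

/-- A `J`-invariant subspace of a real vector space of dimension `6` containing two complex
independent vectors is at most one complex dimension short of the whole space. -/
theorem exists_eq_add_smul_add_smul {J : L →ₗ[ℝ] L} (hJ : ∀ u, J (J u) = -u)
    (hdim : Module.finrank ℝ L = 6) {V W : Submodule ℝ L} (hV : ∀ v ∈ V, J v ∈ V)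
    (hW : ∀ w ∈ W, J w ∈ W) {Z X Y : L} (hZ : Z ≠ 0) (hZV : Z ∈ V) (hVW : V ≤ W) (hXV : X ∉ V)
    (hX : X ∈ W) (hY : Y ∉ W) (U : L) : ∃ w ∈ W, ∃ a b : ℝ, U = w + a • Y + b • J Y := by
  have : FiniteDimensional ℝ L := Module.finite_of_finrank_pos (by omega)
  have key : ∀ (S : Submodule ℝ L), (∀ v ∈ S, J v ∈ S) → ∀ v ∉ S,
      Module.finrank ℝ S + 2 ≤ Module.finrank ℝ ↑(S ⊔ Submodule.span ℝ {v, J v}) := by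
    intro S hS v hv
    have hlt1 : S < S ⊔ Submodule.span ℝ {v} := by
      refine lt_of_le_of_ne le_sup_left fun h => hv ?_
      rw [h]; exact Submodule.mem_sup_right (Submodule.mem_span_singleton_self v)
    have hlt2 : S ⊔ Submodule.span ℝ {v} < S ⊔ Submodule.span ℝ {v, J v} := by
      refine lt_of_le_of_ne (sup_le_sup_left (Submodule.span_mono (by simp)) _) fun h => hv ?_
      have hmem : J v ∈ S ⊔ Submodule.span ℝ {v} := by
        rw [h]; exact Submodule.mem_sup_right (Submodule.subset_span (by simp))
      obtain ⟨s, hs, t, ht, hst⟩ := Submodule.mem_sup.mp hmem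
      obtain ⟨a, rfl⟩ := Submodule.mem_span_singleton.mp ht
      have h2 : (1 + a ^ 2) • v = -(J s + a • s) := by
        have h3 := congrArg J hst
        rw [map_add, map_smul, hJ, ← hst] at h3
        calc (1 + a ^ 2) • v = -(-v) + a ^ 2 • v := by module
          _ = -(J s + a • s) := by rw [← h3]; module
      have h4 : v = (1 + a ^ 2)⁻¹ • -(J s + a • s) := by
        rw [← h2, smul_smul, inv_mul_cancel₀ (by positivity), one_smul]
      rw [h4]
      exact S.smul_mem _ (S.neg_mem (S.add_mem (hS s hs) (S.smul_mem a hs)))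
    have := Submodule.finrank_lt_finrank_of_lt hlt1
    have := Submodule.finrank_lt_finrank_of_lt hlt2
    omega
  have hsup : ∀ (S : Submodule ℝ L) (T : Submodule ℝ L) (v : L), S ≤ T → v ∈ T →
      (∀ v ∈ T, J v ∈ T) → S ⊔ Submodule.span ℝ {v, J v} ≤ T := by
    intro S T v hST hv hT
    refine sup_le hST (Submodule.span_le.mpr ?_)
    rintro _ (rfl | rfl)
    exacts [hv, hT _ hv]
  have h1 := key ⊥ (by simp) Z (by simpa using hZ)
  have h2 := Submodule.finrank_mono (hsup ⊥ V Z bot_le hZV hV)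
  have h3 := key V hV X hXV
  have h4 := Submodule.finrank_mono (hsup V W X hVW hX hW)
  have h5 := key W hW Y hY
  have h6 : W ⊔ Submodule.span ℝ {Y, J Y} = ⊤ := by
    refine Submodule.eq_top_of_finrank_eq (le_antisymm (Submodule.finrank_le _) ?_)
    omega
  have hU : U ∈ W ⊔ Submodule.span ℝ {Y, J Y} := h6 ▸ Submodule.mem_top
  obtain ⟨w, hw, t, ht, rfl⟩ := Submodule.mem_sup.mp hU
  obtain ⟨a, b, rfl⟩ := Submodule.mem_span_pair.mp ht
  exact ⟨w, hw, a, b, by abel⟩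

namespace IsHermitianPair

variable {J : L →ₗ[ℝ] L} {B : L →ₗ[ℝ] L →ₗ[ℝ] ℝ} (h : IsHermitianPair J B)
include h

theorem eq_zero_of_B_self {v : L} (hv : B v v = 0) : v = 0 := by
  by_contra hne
  exact (h.pos v hne).ne' hv

theorem B_self_nonneg (v : L) : 0 ≤ B v v := by
  rcases eq_or_ne v 0 with rfl | hv
  · simp
  · exact (h.pos v hv).le

theorem lie_J_J_of_central {X : L} (hX : ∀ Z : L, ⁅X, Z⁆ = 0) (Z : L) :
    ⁅J X, J Z⁆ = J ⁅J X, Z⁆ := by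
  rw [h.nijenhuis, hX, hX, map_zero, add_zero, add_zero]

theorem dTorsion_of_central {X : L} (hX : ∀ Z : L, ⁅X, Z⁆ = 0) (Y : L) :
    dTorsion J B X (J X) Y (J Y) = 2 * (B ⁅J X, ⁅J X, Y⁆⁆ Y + B ⁅J X, Y⁆ ⁅J X, Y⁆
      + B ⁅J X, ⁅Y, J Y⁆⁆ X) := by
  have hA := h.lie_J_J_of_central hX
  have hX' : ∀ Z : L, ⁅Z, X⁆ = 0 := fun Z => by rw [← lie_skew, hX, neg_zero]
  have hA' : ∀ Z, ⁅J Z, J X⁆ = -J ⁅J X, Z⁆ := fun Z => by rw [← lie_skew, hA]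
  have hA2 : ⁅⁅J X, Y⁆, J X⁆ = -⁅J X, ⁅J X, Y⁆⁆ := by rw [← lie_skew]
  have hjac : B ⁅J X, ⁅Y, J Y⁆⁆ X = B ⁅⁅J X, Y⁆, J Y⁆ X + B ⁅Y, J ⁅J X, Y⁆⁆ X := by
    rw [leibniz_lie (J X) Y (J Y), hA, map_add, LinearMap.add_apply]
  have hsk : B ⁅J Y, ⁅J X, Y⁆⁆ X = - B ⁅⁅J X, Y⁆, J Y⁆ X := by
    rw [← lie_skew, map_neg, LinearMap.neg_apply]
  simp only [dTorsion, torsion, hX, hA, hA', h.sq, map_zero, zero_lie, lie_zero, map_neg, neg_lie,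
    lie_neg, LinearMap.zero_apply, LinearMap.neg_apply, h.hermitian, hX', hsk, hjac, hA2]
  ring

/-- The value on `(X, JX, Y, JY)` when `[X, L]` and `[JX, L]` are central: the sum of the squares of
the brackets of `X, JX` with `Y, JY`, up to terms that contain `[Y, JY]`. -/
theorem dTorsion_of_lie_central
    (hc : ∀ Z : L, (∀ W : L, ⁅Z, W⁆ = 0) → ∀ W : L, ⁅J Z, W⁆ = 0) {X : L}
    (hX : ∀ Z W : L, ⁅⁅X, Z⁆, W⁆ = 0) (hJX : ∀ Z W : L, ⁅⁅J X, Z⁆, W⁆ = 0) (Y : L) :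
    dTorsion J B X (J X) Y (J Y) = B ⁅X, Y⁆ ⁅X, Y⁆ + B ⁅X, J Y⁆ ⁅X, J Y⁆ + B ⁅J X, Y⁆ ⁅J X, Y⁆
      + B ⁅J X, J Y⁆ ⁅J X, J Y⁆ - 2 * B ⁅X, J X⁆ ⁅Y, J Y⁆
      + B ⁅J X, J ⁅Y, J Y⁆⁆ (J X) + B ⁅X, J ⁅Y, J Y⁆⁆ X := by
  have h1 : ∀ Z W : L, ⁅J ⁅X, Z⁆, W⁆ = 0 := fun Z => hc _ (hX Z)
  have h2 : ∀ Z W : L, ⁅J ⁅J X, Z⁆, W⁆ = 0 := fun Z => hc _ (hJX Z)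
  have h1' : ∀ Z W : L, ⁅W, J ⁅X, Z⁆⁆ = 0 := fun Z W => by rw [← lie_skew, h1, neg_zero]
  have h2' : ∀ Z W : L, ⁅W, J ⁅J X, Z⁆⁆ = 0 := fun Z W => by rw [← lie_skew, h2, neg_zero]
  have hs : ∀ W, ⁅J W, J X⁆ = -⁅J X, J W⁆ := fun W => by rw [← lie_skew]
  have hs' : ⁅J X, X⁆ = -⁅X, J X⁆ := by rw [← lie_skew]
  have hs'' : ⁅J Y, Y⁆ = -⁅Y, J Y⁆ := by rw [← lie_skew]
  simp only [dTorsion, torsion, h1, h2, h1', h2', h.sq, hs, hs', hs'', map_zero, map_neg,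
    neg_lie, lie_neg, LinearMap.zero_apply, LinearMap.neg_apply]
  rw [h.symm ⁅Y, J Y⁆]
  ring

end IsHermitianPair

end

/-! ### The central complex line -/

section

variable {L : Type*} [LieRing L] [LieAlgebra ℝ L]

variable (L) in
/-- The center, as a real subspace. -/
def centerSubmodule : Submodule ℝ L where
  carrier := {X | ∀ Z : L, ⁅X, Z⁆ = 0}
  add_mem' hX hY Z := by rw [add_lie, hX, hY, add_zero]
  zero_mem' Z := zero_lie Z
  smul_mem' c X hX Z := by rw [smul_lie, hX, smul_zero]

variable (L) in
/-- The second term of the ascending central series, as a real subspace. -/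
def secondCenter : Submodule ℝ L where
  carrier := {X | ∀ Z : L, ⁅X, Z⁆ ∈ centerSubmodule L}
  add_mem' hX hY Z := by rw [add_lie]; exact add_mem (hX Z) (hY Z)
  zero_mem' Z := by rw [zero_lie]; exact zero_mem _
  smul_mem' c X hX Z := by rw [smul_lie]; exact Submodule.smul_mem _ c (hX Z)

theorem lie_mem_centerSubmodule_comm {X Y : L} (h : ⁅X, Y⁆ ∈ centerSubmodule L) :
    ⁅Y, X⁆ ∈ centerSubmodule L := by
  rw [← lie_skew]; exact neg_mem h

theorem lie_eq_zero_of_mem_center {X : L} (hX : X ∈ centerSubmodule L) (Z : L) : ⁅Z, X⁆ = 0 := by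
  rw [← lie_skew, hX Z, neg_zero]

namespace IsHermitianPair

variable {J : L →ₗ[ℝ] L} {B : L →ₗ[ℝ] L →ₗ[ℝ] ℝ} (h : IsHermitianPair J B)
  (hK : ∀ X Y, dTorsion J B X (J X) Y (J Y) = 0)
include h hK

/-- If `Y` is such that `JX` commutes with `[Y, L]`, the last term of `dTorsion_of_central` and
the second derivative `[JX, [JX, Y]]` vanish, which leaves `|[JX, Y]|² = 0`. -/
theorem J_mem_center [LieRing.IsNilpotent L] {X : L} (hX : X ∈ centerSubmodule L) :
    J X ∈ centerSubmodule L := by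
  set I : Submodule ℝ L := LinearMap.ker (LieAlgebra.ad ℝ L (J X) : L →ₗ[ℝ] L) with hI
  have hmem : ∀ Y, Y ∈ I ↔ ⁅J X, Y⁆ = 0 := fun Y => by simp [hI]
  by_contra hne
  have hItop : I ≠ ⊤ := fun htop => hne fun Z => (hmem Z).mp (htop ▸ Submodule.mem_top)
  obtain ⟨Y, hYI, hY⟩ := exists_notMem_forall_lie_mem I hItop
  have e := h.dTorsion_of_central hX Y
  have e1 : ⁅J X, ⁅J X, Y⁆⁆ = 0 := (hmem _).mp (hY (J X))
  have e2 : ⁅J X, ⁅Y, J Y⁆⁆ = 0 := by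
    rw [← lie_skew Y, lie_neg, (hmem _).mp (hY (J Y)), neg_zero]
  rw [hK, e1, e2] at e
  simp only [map_zero, LinearMap.zero_apply, zero_add, add_zero] at e
  exact hYI ((hmem Y).mpr (h.eq_zero_of_B_self (by linarith)))

/-- Let `C` be the center and `W = C + ⟨X, JX⟩`. By the dimension, `L` is `W` or the sum of `W` and
one complex line, so that `[JX, L]` is contained in `W`. Nilpotency of the action on `W` reduces
this to `C + ⟨X⟩`, and integrability of `J` to `C`. -/
theorem J_mem_secondCenter [LieRing.IsNilpotent L] (hdim : Module.finrank ℝ L = 6) {X : L}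
    (hX : X ∈ secondCenter L) : J X ∈ secondCenter L := by
  set C := centerSubmodule L with hC
  have hCJ : ∀ Z ∈ C, J Z ∈ C := fun Z hZ => h.J_mem_center hK hZ
  by_cases hXC : X ∈ C
  · intro Z
    rw [hCJ X hXC Z]; exact zero_mem _
  set W := C ⊔ Submodule.span ℝ {X, J X} with hW
  have hWmem : ∀ w, w ∈ W ↔ ∃ z ∈ C, ∃ a b : ℝ, w = z + (a • X + b • J X) := by
    intro w
    rw [hW, Submodule.mem_sup]
    constructor
    · rintro ⟨z, hz, t, ht, rfl⟩
      obtain ⟨a, b, rfl⟩ := Submodule.mem_span_pair.mp ht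
      exact ⟨z, hz, a, b, rfl⟩
    · rintro ⟨z, hz, a, b, rfl⟩
      exact ⟨z, hz, _, Submodule.mem_span_pair.mpr ⟨a, b, rfl⟩, rfl⟩
  have hCW : C ≤ W := le_sup_left
  have hXW : X ∈ W := Submodule.mem_sup_right (Submodule.subset_span (by simp))
  have hJXW : J X ∈ W := Submodule.mem_sup_right (Submodule.subset_span (by simp))
  have hWJ : ∀ w ∈ W, J w ∈ W := by
    intro w hw
    obtain ⟨z, hz, a, b, rfl⟩ := (hWmem w).mp hw
    refine (hWmem _).mpr ⟨J z, hCJ z hz, -b, a, ?_⟩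
    rw [map_add, map_add, map_smul, map_smul, h.sq]; module
  have hXr : ∀ Y, ⁅Y, X⁆ ∈ C := fun Y => lie_mem_centerSubmodule_comm (hX Y)
  -- the complex line `L / W` is killed by the action of `JX`, which commutes with `J` modulo `W`
  have hA : ∀ Y, ⁅J X, Y⁆ ∈ W := by
    intro Y
    have hAW : ∀ w ∈ W, ⁅J X, w⁆ ∈ W := by
      intro w hw
      obtain ⟨z, hz, a, b, rfl⟩ := (hWmem w).mp hw
      rw [lie_add, lie_add, lie_smul, lie_smul, lie_self, lie_eq_zero_of_mem_center hz, zero_add,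
        smul_zero, add_zero]
      exact W.smul_mem a (hCW (hXr _))
    by_cases htop : W = ⊤
    · rw [htop]; trivial
    obtain ⟨Y₀, hY₀, hlie⟩ := exists_notMem_forall_lie_mem W htop
    obtain ⟨Z, hZ, hZC⟩ := exists_notMem_forall_lie_mem (⊥ : Submodule ℝ L)
      (fun hbt => hXC (by
        have : X ∈ (⊤ : Submodule ℝ L) := trivial
        rw [← hbt, Submodule.mem_bot] at this
        rw [this]; exact zero_mem _))
    have hZC' : Z ∈ C := fun U => by
      rw [← lie_skew, (Submodule.mem_bot ℝ).mp (hZC U), neg_zero]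
    obtain ⟨w, hw, a, b, rfl⟩ := exists_eq_add_smul_add_smul h.sq hdim hCJ hWJ
      (fun h0 => hZ (by rw [h0]; exact zero_mem _)) hZC' hCW hXC hXW hY₀ Y
    have hJY : ⁅J X, J Y₀⁆ ∈ W := by
      rw [h.nijenhuis]
      exact add_mem (add_mem (hWJ _ (hlie _)) (hWJ _ (hCW (hX _)))) (hCW (hX _))
    rw [lie_add, lie_add, lie_smul, lie_smul]
    exact add_mem (add_mem (hAW w hw) (W.smul_mem a (hlie _))) (W.smul_mem b hJY)
  have hAr : ∀ Y, ⁅Y, J X⁆ ∈ W := fun Y => by rw [← lie_skew]; exact neg_mem (hA Y)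
  set I := C ⊔ Submodule.span ℝ {X} with hI
  have hImem : ∀ w, w ∈ I ↔ ∃ z ∈ C, ∃ a : ℝ, w = z + a • X := by
    intro w
    rw [hI, Submodule.mem_sup]
    constructor
    · rintro ⟨z, hz, t, ht, rfl⟩
      obtain ⟨a, rfl⟩ := Submodule.mem_span_singleton.mp ht
      exact ⟨z, hz, a, rfl⟩
    · rintro ⟨z, hz, a, rfl⟩
      exact ⟨z, hz, _, Submodule.mem_span_singleton.mpr ⟨a, rfl⟩, rfl⟩
  have hCI : C ≤ I := le_sup_left
  by_cases hJXI : J X ∈ I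
  · obtain ⟨z, hz, a, hza⟩ := (hImem _).mp hJXI
    intro Y
    rw [hza, add_lie, hz Y, zero_add, smul_lie]
    exact C.smul_mem a (hX Y)
  obtain ⟨w, hw, hwI, hlie⟩ := exists_mem_notMem_forall_lie_mem W I (by
    intro x w hw
    obtain ⟨z, hz, a, b, rfl⟩ := (hWmem w).mp hw
    rw [lie_add, lie_add, lie_smul, lie_smul, lie_eq_zero_of_mem_center hz, zero_add]
    exact add_mem (W.smul_mem a (hCW (hXr x))) (W.smul_mem b (hAr x))) (fun hle => hJXI (hle hJXW))
  obtain ⟨z, hz, a, b, rfl⟩ := (hWmem w).mp hw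
  have hb : b ≠ 0 := by
    rintro rfl
    exact hwI ((hImem _).mpr ⟨z, hz, a, by simp⟩)
  have hJXlie : ∀ Y, ⁅J X, Y⁆ ∈ I := by
    intro Y
    have h1 := hlie Y
    rw [lie_add, lie_add, lie_smul, lie_smul, lie_eq_zero_of_mem_center hz, zero_add] at h1
    have h2 := I.sub_mem h1 (I.smul_mem a (hCI (hXr Y)))
    rw [add_sub_cancel_left] at h2
    have h3 := I.neg_mem (I.smul_mem b⁻¹ h2)
    rwa [smul_smul, inv_mul_cancel₀ hb, one_smul, lie_skew] at h3
  intro Y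
  obtain ⟨z₁, hz₁, c, hc⟩ := (hImem _).mp (hJXlie Y)
  have hn := h.nijenhuis X Y
  have h1 : J ⁅J X, Y⁆ ∈ I := by
    have : J ⁅J X, Y⁆ = ⁅J X, J Y⁆ - J ⁅X, J Y⁆ - ⁅X, Y⁆ := by rw [hn]; abel
    rw [this]
    exact I.sub_mem (I.sub_mem (hJXlie _) (hCI (hCJ _ (hX _)))) (hCI (hX _))
  rw [hc, map_add, map_smul] at h1
  have h2 : c • J X ∈ I := (I.add_mem_iff_right (hCI (hCJ z₁ hz₁))).mp h1
  have hc0 : c = 0 := by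
    by_contra hc0
    refine hJXI ?_
    have := I.smul_mem c⁻¹ h2
    rwa [smul_smul, inv_mul_cancel₀ hc0, one_smul] at this
  rw [hc, hc0, zero_smul, add_zero]
  exact hz₁

/-- Otherwise there is `Y` outside of the second center `U` with `[Y, L] ⊆ U`. The torsion identity
for `T = [Y, JY]` and `Y` shows that `T` is central, and then `[Y, L]` is central since `L` is the
sum of `U` and the complex line of `Y`. -/
theorem lie_mem_center [LieRing.IsNilpotent L] (hdim : Module.finrank ℝ L = 6) (X Y : L) :
    ⁅X, Y⁆ ∈ centerSubmodule L := by
  set C := centerSubmodule L with hC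
  set U := secondCenter L with hU
  have hCJ : ∀ Z ∈ C, J Z ∈ C := fun Z hZ => h.J_mem_center hK hZ
  have hUJ : ∀ Z ∈ U, J Z ∈ U := fun Z hZ => h.J_mem_secondCenter hK hdim hZ
  have hCU : C ≤ U := fun Z hZ W => by rw [hZ W]; exact zero_mem _
  suffices hUtop : U = ⊤ from (hUtop ▸ Submodule.mem_top : X ∈ U) Y
  by_contra hne
  obtain ⟨Y, hYU, hY⟩ := exists_notMem_forall_lie_mem U hne
  obtain ⟨X, hXC, hX⟩ := exists_notMem_forall_lie_mem C
    (fun htop => hne (top_le_iff.mp (htop ▸ hCU)))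
  have hXU : X ∈ U := fun Z => lie_mem_centerSubmodule_comm (hX Z)
  obtain ⟨Z, hZ, hZC⟩ := exists_notMem_forall_lie_mem (⊥ : Submodule ℝ L)
      (fun hbt => hXC (by
        have : X ∈ (⊤ : Submodule ℝ L) := trivial
        rw [← hbt, Submodule.mem_bot] at this
        rw [this]; exact zero_mem _))
  have hZC' : Z ∈ C := fun U => by
    rw [← lie_skew, (Submodule.mem_bot ℝ).mp (hZC U), neg_zero]
  have hdec := exists_eq_add_smul_add_smul h.sq hdim hCJ hUJ
      (fun h0 => hZ (by rw [h0]; exact zero_mem _)) hZC' hCU hXC hXU hYU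
  set T := ⁅Y, J Y⁆ with hT
  have hTU : T ∈ U := by rw [hT, ← lie_skew]; exact neg_mem (hY _)
  have hTw : ∀ w ∈ U, ⁅T, w⁆ = 0 := by
    intro w hw
    rw [hT, lie_lie, lie_eq_zero_of_mem_center (lie_mem_centerSubmodule_comm (hw _)),
      lie_eq_zero_of_mem_center (lie_mem_centerSubmodule_comm (hw _)), sub_zero]
  have e := h.dTorsion_of_lie_central hCJ (fun Z => hTU Z) (fun Z => hUJ T hTU Z) Y
  rw [hK, ← hT, hTw _ (hUJ T hTU), lie_self] at e
  simp only [map_zero, LinearMap.zero_apply, mul_zero, sub_zero, add_zero] at e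
  have p1 := h.B_self_nonneg ⁅T, Y⁆
  have p2 := h.B_self_nonneg ⁅T, J Y⁆
  have p3 := h.B_self_nonneg ⁅J T, Y⁆
  have p4 := h.B_self_nonneg ⁅J T, J Y⁆
  have q1 : ⁅T, Y⁆ = 0 := h.eq_zero_of_B_self (by linarith)
  have q2 : ⁅T, J Y⁆ = 0 := h.eq_zero_of_B_self (by linarith)
  have hTC : T ∈ C := by
    intro V
    obtain ⟨w, hw, a, b, rfl⟩ := hdec V
    rw [lie_add, lie_add, lie_smul, lie_smul, q1, q2, hTw w hw]; simp
  refine hYU fun V => ?_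
  obtain ⟨w, hw, a, b, rfl⟩ := hdec V
  rw [lie_add, lie_add, lie_smul, lie_smul, lie_self, ← hT, smul_zero, add_zero]
  exact add_mem (lie_mem_centerSubmodule_comm (hw Y)) (C.smul_mem b hTC)

/-- The derived algebra is contained in a central complex line. -/
theorem exists_central_line [LieRing.IsNilpotent L] (hdim : Module.finrank ℝ L = 6) :
    ∃ T ∈ centerSubmodule L, T ≠ 0 ∧ ∀ X Y : L, ∃ a b : ℝ, ⁅X, Y⁆ = a • T + b • J T := by
  set C := centerSubmodule L with hC
  have hCJ : ∀ Z ∈ C, J Z ∈ C := fun Z hZ => h.J_mem_center hK hZ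
  have hLC := h.lie_mem_center hK hdim
  have : Nontrivial L := Module.nontrivial_of_finrank_pos (R := ℝ) (by omega)
  obtain ⟨Z, hZ, hZC⟩ := exists_notMem_forall_lie_mem (⊥ : Submodule ℝ L) bot_ne_top
  have hZC' : Z ∈ C := fun U => by
    rw [← lie_skew, (Submodule.mem_bot ℝ).mp (hZC U), neg_zero]
  have hZ0 : Z ≠ 0 := fun h0 => hZ (by rw [h0]; exact zero_mem _)
  by_cases h1 : C ≤ Submodule.span ℝ {Z, J Z}
  · refine ⟨Z, hZC', hZ0, fun X Y => ?_⟩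
    obtain ⟨a, b, hab⟩ := Submodule.mem_span_pair.mp (h1 (hLC X Y))
    exact ⟨a, b, hab.symm⟩
  by_cases h2 : C = ⊤
  · exact ⟨Z, hZC', hZ0, fun X Y => ⟨0, 0, by
      rw [(h2 ▸ Submodule.mem_top : X ∈ C) Y]; simp⟩⟩
  obtain ⟨X, hXC, hX⟩ := Set.not_subset.mp h1
  obtain ⟨Y, -, hY⟩ := Set.not_subset.mp (fun hle => h2 (top_le_iff.mp hle))
  have hdec := exists_eq_add_smul_add_smul h.sq hdim (V := Submodule.span ℝ {Z, J Z}) (W := C)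
    (by
      intro v hv
      obtain ⟨a, b, rfl⟩ := Submodule.mem_span_pair.mp hv
      exact Submodule.mem_span_pair.mpr ⟨-b, a, by
        rw [map_add, map_smul, map_smul, h.sq]; module⟩) hCJ hZ0
    (Submodule.subset_span (by simp)) (Submodule.span_le.mpr (by
      rintro _ (rfl | rfl)
      exacts [hZC', hCJ _ hZC'])) hX hXC hY
  have hlie : ∀ U V : L, ∃ a : ℝ, ⁅U, V⁆ = a • ⁅Y, J Y⁆ := by
    intro U V
    obtain ⟨w, hw, a, b, rfl⟩ := hdec U
    obtain ⟨w', hw', a', b', rfl⟩ := hdec V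
    refine ⟨a * b' - b * a', ?_⟩
    simp only [add_lie, lie_add, smul_lie, lie_smul, lie_self, hw _,
      lie_eq_zero_of_mem_center hw']
    rw [← lie_skew Y (J Y)]
    module
  by_cases hT : ⁅Y, J Y⁆ = 0
  · refine ⟨Z, hZC', hZ0, fun U V => ⟨0, 0, ?_⟩⟩
    obtain ⟨a, ha⟩ := hlie U V
    rw [ha, hT]; simp
  · refine ⟨⁅Y, J Y⁆, hLC _ _, hT, fun U V => ?_⟩
    obtain ⟨a, ha⟩ := hlie U V
    exact ⟨a, 0, by rw [ha]; simp⟩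

end IsHermitianPair

end

/-! ### Adapted coframes -/

section

variable {L : Type*} [LieRing L] [LieAlgebra ℝ L]

/-- A basis of the space of `(1,0)`-forms for `J`, on a vector space of real dimension `6`. -/
structure IsCoframe (J : L →ₗ[ℝ] L) (z : Fin 3 → L →ₗ[ℝ] ℂ) : Prop where
  type_one_zero : ∀ i u, z i (J u) = I * z i u
  eq_zero : ∀ u, (∀ i, z i u = 0) → u = 0

/-- The value of `ρ ω¹² + A ω^{1 1̄} + B ω^{1 2̄} + C ω^{2 1̄} + D ω^{2 2̄}` on a pair of vectors
on which `(ω¹, ω²)` takes the values `(p, q)` and `(p', q')`. -/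
def twoForm (ρ A B C D p q p' q' : ℂ) : ℂ :=
  ρ * (p * q' - p' * q) + A * (p * conj p' - p' * conj p) + B * (p * conj q' - p' * conj q)
    + C * (q * conj p' - q' * conj p) + D * (q * conj q' - q' * conj q)

/-- There is a `(1,0)`-coframe with `dω¹ = dω² = 0` and
`dω³ = ρ ω¹² + A ω^{1 1̄} + B ω^{1 2̄} + C ω^{2 1̄} + D ω^{2 2̄}`. -/
def HasCoframe (J : L →ₗ[ℝ] L) (ρ A B C D : ℂ) : Prop :=
  ∃ z : Fin 3 → L →ₗ[ℝ] ℂ, IsCoframe J z ∧ (∀ u v : L, z 0 ⁅u, v⁆ = 0) ∧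
    (∀ u v : L, z 1 ⁅u, v⁆ = 0) ∧
    ∀ u v : L, z 2 ⁅u, v⁆ = -twoForm ρ A B C D (z 0 u) (z 1 u) (z 0 v) (z 1 v)

/-- A nonzero vector is part of a complex basis `Y₁, Y₂, T`, with dual `(1,0)`-coframe `z`. -/
theorem exists_complex_basis {J : L →ₗ[ℝ] L} (hJ : ∀ u, J (J u) = -u)
    (hdim : Module.finrank ℝ L = 6) {T : L} (hT : T ≠ 0) :
    ∃ (Y₁ Y₂ : L) (z : Fin 3 → L →ₗ[ℝ] ℂ), IsCoframe J z ∧ (z 0 Y₁ = 1 ∧ z 0 Y₂ = 0 ∧ z 0 T = 0) ∧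
      (z 1 Y₁ = 0 ∧ z 1 Y₂ = 1 ∧ z 1 T = 0) ∧ (z 2 Y₁ = 0 ∧ z 2 Y₂ = 0 ∧ z 2 T = 1) ∧
      ∀ u, u = (z 0 u).re • Y₁ + (z 0 u).im • J Y₁ + (z 1 u).re • Y₂ + (z 1 u).im • J Y₂
        + (z 2 u).re • T + (z 2 u).im • J T := by
  have : FiniteDimensional ℝ L := Module.finite_of_finrank_pos (by omega)
  have hproper : ∀ s : Finset L, s.card < 6 → ∃ Y, Y ∉ Submodule.span ℝ (s : Set L) := by
    intro s hs
    by_contra! hall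
    have h1 : Submodule.span ℝ (s : Set L) = ⊤ := Submodule.eq_top_iff'.mpr hall
    have h2 := finrank_span_finset_le_card (R := ℝ) s
    rw [Set.finrank, h1, finrank_top] at h2
    omega
  classical
  obtain ⟨Y₁, hY₁⟩ := hproper {T, J T} (lt_of_le_of_lt Finset.card_le_two (by norm_num))
  obtain ⟨Y₂, hY₂⟩ := hproper {T, J T, Y₁, J Y₁}
    (lt_of_le_of_lt Finset.card_le_four (by norm_num))
  push_cast at hY₁ hY₂
  have hdec := exists_eq_add_smul_add_smul hJ hdim (V := Submodule.span ℝ {T, J T})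
    (W := Submodule.span ℝ ({T, J T, Y₁, J Y₁} : Set L))
    (fun v hv => by
      obtain ⟨a, b, rfl⟩ := Submodule.mem_span_pair.mp hv
      exact Submodule.mem_span_pair.mpr ⟨-b, a, by
        rw [map_add, map_smul, map_smul, hJ]; module⟩)
    (fun v hv => by
      have : Submodule.span ℝ ({T, J T, Y₁, J Y₁} : Set L) ≤
          (Submodule.span ℝ ({T, J T, Y₁, J Y₁} : Set L)).comap J := by
        refine Submodule.span_le.mpr ?_
        rintro _ (rfl | rfl | rfl | rfl)
        · exact Submodule.subset_span (by simp)
        · rw [SetLike.mem_coe, Submodule.mem_comap, hJ]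
          exact neg_mem (Submodule.subset_span (by simp))
        · exact Submodule.subset_span (by simp)
        · rw [SetLike.mem_coe, Submodule.mem_comap, hJ]
          exact neg_mem (Submodule.subset_span (by simp))
      exact this hv) hT (Submodule.subset_span (by simp))
    (Submodule.span_mono (by
      rintro _ (rfl | rfl) <;> simp)) hY₁ (Submodule.subset_span (by simp)) hY₂
  set f : Fin 6 → L := ![Y₁, J Y₁, Y₂, J Y₂, T, J T] with hf
  have htop : ⊤ ≤ Submodule.span ℝ (Set.range f) := by
    intro u _
    have hmem : ∀ i, f i ∈ Submodule.span ℝ (Set.range f) := fun i =>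
      Submodule.subset_span ⟨i, rfl⟩
    obtain ⟨w, hw, a, b, rfl⟩ := hdec u
    have hle : Submodule.span ℝ ({T, J T, Y₁, J Y₁} : Set L) ≤ Submodule.span ℝ (Set.range f) := by
      refine Submodule.span_le.mpr ?_
      rintro _ (rfl | rfl | rfl | rfl)
      exacts [hmem 4, hmem 5, hmem 0, hmem 1]
    exact add_mem (add_mem (hle hw) (Submodule.smul_mem _ a (hmem 2)))
      (Submodule.smul_mem _ b (hmem 3))
  set e := basisOfTopLeSpanOfCardEqFinrank f htop (by simp [hdim]) with he
  have hef : ∀ i, e i = f i := fun i => by rw [he, coe_basisOfTopLeSpanOfCardEqFinrank]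
  have hrepr : ∀ u, u = e.coord 0 u • Y₁ + e.coord 1 u • J Y₁ + e.coord 2 u • Y₂
      + e.coord 3 u • J Y₂ + e.coord 4 u • T + e.coord 5 u • J T := by
    intro u
    conv_lhs => rw [← e.sum_repr u]
    simp only [Fin.sum_univ_six, hef]
    rfl
  have hc : ∀ i j, e.coord i (f j) = if j = i then 1 else 0 := fun i j => by
    rw [← hef j, Module.Basis.coord_apply, e.repr_self, Finsupp.single_apply]
  have hcJ : ∀ u, e.coord 0 (J u) = -e.coord 1 u ∧ e.coord 1 (J u) = e.coord 0 u ∧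
      e.coord 2 (J u) = -e.coord 3 u ∧ e.coord 3 (J u) = e.coord 2 u ∧
      e.coord 4 (J u) = -e.coord 5 u ∧ e.coord 5 (J u) = e.coord 4 u := by
    intro u
    have hJu : J u = e.coord 0 u • f 1 + -e.coord 1 u • f 0 + e.coord 2 u • f 3
      + -e.coord 3 u • f 2 + e.coord 4 u • f 5 + -e.coord 5 u • f 4 := by
      conv_lhs => rw [hrepr u]
      simp only [map_add, map_smul, hJ, hf]
      simp
    refine ⟨?_, ?_, ?_, ?_, ?_, ?_⟩ <;>
    · rw [hJu]
      simp only [map_add, map_smul, hc]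
      simp
  let z : Fin 3 → L →ₗ[ℝ] ℂ := ![
    ofRealLI.toLinearMap ∘ₗ e.coord 0 + LinearMap.mulLeft ℝ I ∘ₗ ofRealLI.toLinearMap ∘ₗ e.coord 1,
    ofRealLI.toLinearMap ∘ₗ e.coord 2 + LinearMap.mulLeft ℝ I ∘ₗ ofRealLI.toLinearMap ∘ₗ e.coord 3,
    ofRealLI.toLinearMap ∘ₗ e.coord 4 + LinearMap.mulLeft ℝ I ∘ₗ ofRealLI.toLinearMap ∘ₗ e.coord 5]
  have z0 : ∀ u, z 0 u = e.coord 0 u + I * e.coord 1 u := fun u => rfl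
  have z1 : ∀ u, z 1 u = e.coord 2 u + I * e.coord 3 u := fun u => rfl
  have z2 : ∀ u, z 2 u = e.coord 4 u + I * e.coord 5 u := fun u => rfl
  refine ⟨Y₁, Y₂, z, ⟨?_, ?_⟩, ?_, ?_, ?_, ?_⟩
  · intro i u
    obtain ⟨h0, h1, h2, h3, h4, h5⟩ := hcJ u
    fin_cases i
    · change z 0 (J u) = I * z 0 u
      rw [z0, z0, h0, h1]; push_cast; linear_combination -(e.coord 1 u : ℂ) * I_mul_I
    · change z 1 (J u) = I * z 1 u
      rw [z1, z1, h2, h3]; push_cast; linear_combination -(e.coord 3 u : ℂ) * I_mul_I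
    · change z 2 (J u) = I * z 2 u
      rw [z2, z2, h4, h5]; push_cast; linear_combination -(e.coord 5 u : ℂ) * I_mul_I
  · intro u hu
    have h0 := hu 0
    have h1 := hu 1
    have h2 := hu 2
    rw [z0, Complex.ext_iff] at h0
    rw [z1, Complex.ext_iff] at h1
    rw [z2, Complex.ext_iff] at h2
    simp at h0 h1 h2
    rw [hrepr u]
    simp [h0, h1, h2]
  · rw [z0, z0, z0]
    simp only [show Y₁ = f 0 from rfl, show Y₂ = f 2 from rfl, show T = f 4 from rfl, hc]
    simp
  · rw [z1, z1, z1]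
    simp only [show Y₁ = f 0 from rfl, show Y₂ = f 2 from rfl, show T = f 4 from rfl, hc]
    simp
  · rw [z2, z2, z2]
    simp only [show Y₁ = f 0 from rfl, show Y₂ = f 2 from rfl, show T = f 4 from rfl, hc]
    simp
  · intro u
    conv_lhs => rw [hrepr u]
    simp [z0, z1, z2]

/-- A coframe adapted to the central line that contains the brackets. The coefficients are computed
from the brackets `p, q, r, a, d` of the complex basis; the pluriclosed condition on the vectors
`Y₁, Y₂` is a relation between their squared moduli. -/
theorem IsHermitianPair.exists_hasCoframe [LieRing.IsNilpotent L]
    (hdim : Module.finrank ℝ L = 6) {J : L →ₗ[ℝ] L} {g : L →ₗ[ℝ] L →ₗ[ℝ] ℝ}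
    (h : IsHermitianPair J g) (hK : ∀ X Y, dTorsion J g X (J X) Y (J Y) = 0) :
    ∃ ρ A B C D : ℂ, HasCoframe J ρ A B C D ∧
      normSq ρ + normSq B + normSq C = 2 * (A * conj D).re := by
  obtain ⟨T, hTC, hT, hline⟩ := h.exists_central_line hK hdim
  obtain ⟨Y₁, Y₂, z, hz, h0, h1, h2, hdec⟩ := exists_complex_basis h.sq hdim hT
  have hLC := h.lie_mem_center hK hdim
  have hJTC := h.J_mem_center hK hTC
  have hz0 : ∀ u v : L, z 0 ⁅u, v⁆ = 0 := by
    intro u v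
    obtain ⟨a, b, hab⟩ := hline u v
    rw [hab, map_add, map_smul, map_smul, hz.type_one_zero, h0.2.2]; simp
  have hz1 : ∀ u v : L, z 1 ⁅u, v⁆ = 0 := by
    intro u v
    obtain ⟨a, b, hab⟩ := hline u v
    rw [hab, map_add, map_smul, map_smul, hz.type_one_zero, h1.2.2]; simp
  have hbr : ∀ u v : L, ⁅u, v⁆ = (z 2 ⁅u, v⁆).re • T + (z 2 ⁅u, v⁆).im • J T := by
    intro u v
    conv_lhs => rw [hdec ⁅u, v⁆, hz0, hz1]
    simp
  have hg : ∀ u v u' v' : L, g ⁅u, v⁆ ⁅u', v'⁆ = g T T * (z 2 ⁅u, v⁆ * conj (z 2 ⁅u', v'⁆)).re := by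
    intro u v u' v'
    have hTJ : g T (J T) = 0 := by
      have := h.B_J_left T T
      rw [h.symm (J T) T] at this
      linarith
    have hJT : g (J T) T = 0 := by rw [h.symm, hTJ]
    rw [hbr u v, hbr u' v']
    simp only [map_add, map_smul, LinearMap.add_apply, LinearMap.smul_apply, hTJ, hJT,
      h.hermitian, smul_eq_mul, h2.2.2, hz.type_one_zero, real_smul]
    simp
    ring
  set p := z 2 ⁅Y₁, Y₂⁆ with hp
  set q := z 2 ⁅Y₁, J Y₂⁆ with hq
  set r := z 2 ⁅J Y₁, Y₂⁆ with hr
  set a := z 2 ⁅Y₁, J Y₁⁆ with ha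
  set d := z 2 ⁅Y₂, J Y₂⁆ with hd
  have hs : z 2 ⁅J Y₁, J Y₂⁆ = I * (q + r) + p := by
    rw [h.nijenhuis, map_add, map_add, hz.type_one_zero, hz.type_one_zero]; ring
  have hskt := h.dTorsion_of_lie_central (fun Z hZ => h.J_mem_center hK hZ)
    (fun Z => hLC Y₁ Z) (fun Z => hLC (J Y₁) Z) Y₂
  rw [hK, lie_eq_zero_of_mem_center (h.J_mem_center hK (hLC Y₂ (J Y₂))),
    lie_eq_zero_of_mem_center (h.J_mem_center hK (hLC Y₂ (J Y₂))), hg, hg, hg, hg, hg, hs] at hskt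
  simp only [map_zero, LinearMap.zero_apply, add_zero, ← hp, ← hq, ← hr, ← ha, ← hd] at hskt
  have hgT : g T T ≠ 0 := (h.pos T hT).ne'
  refine ⟨I * (q + r) / 2, -I * a / 2, I * (r - q) / 4 - (p + I * (q + r) / 2) / 2,
    I * (r - q) / 4 + (p + I * (q + r) / 2) / 2, -I * d / 2, ⟨z, hz, hz0, hz1, ?_⟩, ?_⟩
  · intro u v
    have key : ∀ x₁ y₁ x₂ y₂ x₃ y₃ x₁' y₁' x₂' y₂' x₃' y₃' : ℝ,
        z 2 ⁅x₁ • Y₁ + y₁ • J Y₁ + x₂ • Y₂ + y₂ • J Y₂ + x₃ • T + y₃ • J T,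
          x₁' • Y₁ + y₁' • J Y₁ + x₂' • Y₂ + y₂' • J Y₂ + x₃' • T + y₃' • J T⁆ =
        (x₁ * y₁' - y₁ * x₁') * a + (x₂ * y₂' - y₂ * x₂') * d + (x₁ * x₂' - x₂ * x₁') * p
        + (x₁ * y₂' - y₂ * x₁') * q + (y₁ * x₂' - x₂ * y₁') * r
        + (y₁ * y₂' - y₂ * y₁') * (I * (q + r) + p) := by
      intro x₁ y₁ x₂ y₂ x₃ y₃ x₁' y₁' x₂' y₂' x₃' y₃'
      simp only [add_lie, lie_add, smul_lie, lie_smul, lie_self, hTC _, hJTC _,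
        lie_eq_zero_of_mem_center hTC, lie_eq_zero_of_mem_center hJTC]
      rw [← lie_skew (J Y₁) Y₁, ← lie_skew Y₂ Y₁, ← lie_skew (J Y₂) Y₁, ← lie_skew Y₂ (J Y₁),
        ← lie_skew (J Y₂) (J Y₁), ← lie_skew (J Y₂) Y₂]
      simp only [map_add, map_smul, map_neg, map_zero, smul_zero, add_zero, hs, ← hp, ← hq, ← hr,
        ← ha, ← hd, real_smul]
      ring
    have hform : ∀ x₁ y₁ x₂ y₂ x₁' y₁' x₂' y₂' : ℝ,
        (x₁ * y₁' - y₁ * x₁') * a + (x₂ * y₂' - y₂ * x₂') * d + (x₁ * x₂' - x₂ * x₁') * p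
        + (x₁ * y₂' - y₂ * x₁') * q + (y₁ * x₂' - x₂ * y₁') * r
        + (y₁ * y₂' - y₂ * y₁') * (I * (q + r) + p) =
        -twoForm (I * (q + r) / 2) (-I * a / 2) (I * (r - q) / 4 - (p + I * (q + r) / 2) / 2)
          (I * (r - q) / 4 + (p + I * (q + r) / 2) / 2) (-I * d / 2)
          (x₁ + y₁ * I) (x₂ + y₂ * I) (x₁' + y₁' * I) (x₂' + y₂' * I) := by
      intro x₁ y₁ x₂ y₂ x₁' y₁' x₂' y₂'
      simp only [twoForm, map_add, map_mul, conj_ofReal, conj_I]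
      ring_nf
      simp only [I_sq, I_pow_three]
      ring
    conv_lhs => rw [hdec u, hdec v, key, hform]
    simp only [re_add_im]
  · have e : ((0 : ℝ)) = (p * conj p).re + (q * conj q).re + (r * conj r).re
        + ((I * (q + r) + p) * conj (I * (q + r) + p)).re - 2 * (a * conj d).re := by
      apply mul_left_cancel₀ hgT
      linear_combination hskt
    simp [normSq_apply, map_div₀, map_ofNat] at e ⊢
    linear_combination -e / 4

end

/-! ### Real structure equations -/

section

variable {L : Type*} [LieRing L] [LieAlgebra ℝ L]

/-- The Lie algebra has a basis with the given real structure equations, as in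
`LieAlgebraHasEquations`. -/
def HasRealEquations (L : Type*) [LieRing L] [LieAlgebra ℝ L]
    (F : (Fin 6 → Fin 6 → L → L → ℝ) → Fin 6 → L → L → ℝ) : Prop :=
  ∃ b : Module.Basis (Fin 6) ℝ L, ∀ (k : Fin 6) (u v : L),
      -(b.coord k ⁅u, v⁆) =
        F (fun i j u v => b.coord i u * b.coord j v - b.coord i v * b.coord j u) k u v

theorem hasRealEquations_of_forms (hdim : Module.finrank ℝ L = 6)
    {F : (Fin 6 → Fin 6 → L → L → ℝ) → Fin 6 → L → L → ℝ} (f : Fin 6 → L →ₗ[ℝ] ℝ)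
    (hinj : ∀ u, (∀ i, f i u = 0) → u = 0)
    (hd : ∀ k u v, -(f k ⁅u, v⁆) =
      F (fun i j u v => f i u * f j v - f i v * f j u) k u v) : HasRealEquations L F := by
  have : FiniteDimensional ℝ L := Module.finite_of_finrank_pos (by omega)
  have hf : Function.Injective (LinearMap.pi f) := by
    rw [injective_iff_map_eq_zero]
    exact fun u hu => hinj u fun i => congrFun hu i
  set b := Module.Basis.ofEquivFun (LinearMap.linearEquivOfInjective (LinearMap.pi f) hf
    (by simp [hdim])) with hb
  have hbf : ∀ i u, b.coord i u = f i u := fun i u => by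
    rw [hb, Module.Basis.coord_apply, Module.Basis.ofEquivFun_repr_apply]; rfl
  exact ⟨b, fun k u v => by simp only [hbf]; exact hd k u v⟩

/-- With `α = e⁰ + i e¹`, `β = e² + i e³`, `γ = e⁴ + i e⁵`, the equations
`(0, 0, 0, 0, 13 + 42, 14 + 23)` are `dα = dβ = 0`, `dγ = α ∧ β`. -/
theorem hasRealEquations_of_complex_heisenberg (hdim : Module.finrank ℝ L = 6)
    (α β γ : L →ₗ[ℝ] ℂ) (hinj : ∀ u, α u = 0 → β u = 0 → γ u = 0 → u = 0)
    (hα : ∀ u v : L, α ⁅u, v⁆ = 0) (hβ : ∀ u v : L, β ⁅u, v⁆ = 0)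
    (hγ : ∀ u v : L, γ ⁅u, v⁆ = -(α u * β v - α v * β u)) :
    HasRealEquations L fun e => ![0, 0, 0, 0, e 0 2 + e 3 1, e 0 3 + e 1 2] := by
  refine hasRealEquations_of_forms hdim ![reLm ∘ₗ α, imLm ∘ₗ α, reLm ∘ₗ β, imLm ∘ₗ β,
    reLm ∘ₗ γ, imLm ∘ₗ γ] (fun u hu => hinj u ?_ ?_ ?_) fun k u v => ?_
  · exact Complex.ext (hu 0) (hu 1)
  · exact Complex.ext (hu 2) (hu 3)
  · exact Complex.ext (hu 4) (hu 5)
  · fin_cases k <;> simp [hα, hβ, hγ] <;> ring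

variable {J : L →ₗ[ℝ] L}

theorem HasCoframe.h1 (hdim : Module.finrank ℝ L = 6) (h : HasCoframe J 0 0 0 0 0) :
    HasRealEquations L fun _ => ![0, 0, 0, 0, 0, 0] := by
  obtain ⟨z, hz, h0, h1, h2⟩ := h
  refine hasRealEquations_of_forms hdim ![reLm ∘ₗ z 0, imLm ∘ₗ z 0, reLm ∘ₗ z 1, imLm ∘ₗ z 1,
    reLm ∘ₗ z 2, imLm ∘ₗ z 2] (fun u hu => hz.eq_zero u fun i => ?_) fun k u v => ?_
  · fin_cases i
    exacts [Complex.ext (hu 0) (hu 1), Complex.ext (hu 2) (hu 3), Complex.ext (hu 4) (hu 5)]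
  · fin_cases k <;> simp [h0, h1, h2, twoForm]

theorem HasCoframe.h8 (hdim : Module.finrank ℝ L = 6) (h : HasCoframe J 0 1 0 0 0) :
    HasRealEquations L fun e => ![0, 0, 0, 0, 0, e 0 1] := by
  obtain ⟨z, hz, h0, h1, h2⟩ := h
  refine hasRealEquations_of_forms hdim ![reLm ∘ₗ z 0, imLm ∘ₗ z 0, reLm ∘ₗ z 1, imLm ∘ₗ z 1,
    reLm ∘ₗ z 2, (-1 / 2 : ℝ) • imLm ∘ₗ z 2] (fun u hu => hz.eq_zero u fun i => ?_) fun k u v => ?_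
  · have h5 : (z 2 u).im = 0 := by simpa using hu 5
    fin_cases i
    exacts [Complex.ext (hu 0) (hu 1), Complex.ext (hu 2) (hu 3), Complex.ext (hu 4) h5]
  · fin_cases k <;> simp [h0, h1, h2, twoForm] <;> ring

theorem HasCoframe.h2_of_abelian (hdim : Module.finrank ℝ L = 6) (h : HasCoframe J 0 1 0 0 I) :
    HasRealEquations L fun e => ![0, 0, 0, 0, e 0 1, e 2 3] := by
  obtain ⟨z, hz, h0, h1, h2⟩ := h
  refine hasRealEquations_of_forms hdim ![reLm ∘ₗ z 0, imLm ∘ₗ z 0, reLm ∘ₗ z 1, imLm ∘ₗ z 1,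
    (-1 / 2 : ℝ) • imLm ∘ₗ z 2, (1 / 2 : ℝ) • reLm ∘ₗ z 2]
    (fun u hu => hz.eq_zero u fun i => ?_) fun k u v => ?_
  · have h4 : (z 2 u).im = 0 := by simpa using hu 4
    have h5 : (z 2 u).re = 0 := by simpa using hu 5
    fin_cases i
    exacts [Complex.ext (hu 0) (hu 1), Complex.ext (hu 2) (hu 3), Complex.ext h5 h4]
  · fin_cases k <;> simp [h0, h1, h2, twoForm] <;> ring

theorem HasCoframe.h4 (hdim : Module.finrank ℝ L = 6) (h : HasCoframe J 1 1 1 0 1) :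
    HasRealEquations L fun e => ![0, 0, 0, 0, e 0 1, e 0 3 + e 1 2] := by
  obtain ⟨z, hz, h0, h1, h2⟩ := h
  refine hasRealEquations_of_forms hdim ![reLm ∘ₗ z 0, reLm ∘ₗ z 1,
    -(imLm ∘ₗ z 0 + imLm ∘ₗ z 1), -(imLm ∘ₗ z 0),
    (1 / 2 : ℝ) • reLm ∘ₗ z 2, (1 / 2 : ℝ) • imLm ∘ₗ z 2]
    (fun u hu => hz.eq_zero u fun i => ?_) fun k u v => ?_
  · have h3 : (z 0 u).im = 0 := by simpa using hu 3
    have h2 : (z 1 u).im = 0 := by simpa [h3] using hu 2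
    have h4 : (z 2 u).re = 0 := by simpa using hu 4
    have h5 : (z 2 u).im = 0 := by simpa using hu 5
    fin_cases i
    exacts [Complex.ext (hu 0) h3, Complex.ext (hu 1) h2, Complex.ext h4 h5]
  · fin_cases k <;> simp [h0, h1, h2, twoForm] <;> ring

/-- The decomposable members of the pencil of the real `2`-forms `Re dω³` and `Im dω³` are
`Re dω³` and `Im dω³ + Re dω³ / Im D`. -/
theorem HasCoframe.h2_of_re_eq_one (hdim : Module.finrank ℝ L = 6) {D : ℂ} (hre : D.re = 1)
    (him : D.im ≠ 0) (h : HasCoframe J 1 1 1 0 D) :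
    HasRealEquations L fun e => ![0, 0, 0, 0, e 0 1, e 2 3] := by
  obtain ⟨z, hz, h0, h1, h2⟩ := h
  refine hasRealEquations_of_forms hdim ![reLm ∘ₗ z 0 - D.im • imLm ∘ₗ z 1, reLm ∘ₗ z 1,
    reLm ∘ₗ z 0 + reLm ∘ₗ z 1, D.im⁻¹ • reLm ∘ₗ z 1 - imLm ∘ₗ z 0,
    (1 / 2 : ℝ) • reLm ∘ₗ z 2, (1 / 2 : ℝ) • imLm ∘ₗ z 2 + (D.im⁻¹ / 2) • reLm ∘ₗ z 2]
    (fun u hu => hz.eq_zero u fun i => ?_) fun k u v => ?_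
  · have e1 : (z 1 u).re = 0 := by simpa using hu 1
    have e2 : (z 0 u).re = 0 := by simpa [e1] using hu 2
    have e3 : (z 0 u).im = 0 := by simpa [e1] using hu 3
    have e0 : (z 1 u).im = 0 := by simpa [e2, him] using hu 0
    have e4 : (z 2 u).re = 0 := by simpa using hu 4
    have e5 : (z 2 u).im = 0 := by simpa [e4] using hu 5
    fin_cases i
    exacts [Complex.ext e2 e3, Complex.ext e1 e0, Complex.ext e4 e5]
  · fin_cases k <;> simp [h0, h1, h2, twoForm, hre] <;> field_simp <;> ring

/-- For `|D| < 1` and `Re D = 1 / 2` a suitable combination `dω³ + b dω̄³` is the product of two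
complex `1`-forms. The number `b` is a root of `D̄ b² - 2 b + D`, the condition that its square
is zero. -/
theorem HasCoframe.h5 (hdim : Module.finrank ℝ L = 6) {D : ℂ} (hre : D.re = 1 / 2)
    (hnorm : normSq D < 1) (h : HasCoframe J 1 1 0 0 D) :
    HasRealEquations L fun e => ![0, 0, 0, 0, e 0 2 + e 3 1, e 0 3 + e 1 2] := by
  obtain ⟨z, hz, h0, h1, h2⟩ := h
  set s := Real.sqrt (1 - normSq D) with hs
  have hs2 : s ^ 2 = 1 - normSq D := Real.sq_sqrt (by linarith)
  have hs0 : 0 < s := Real.sqrt_pos.mpr (by linarith)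
  have hD : D ≠ 0 := by rintro rfl; norm_num at hre
  have hDc : conj D ≠ 0 := by simpa using hD
  have hDD : D * conj D = 1 - (s : ℂ) ^ 2 := by
    rw [mul_conj]; exact_mod_cast (by linarith : normSq D = 1 - s ^ 2)
  have hDs : D + conj D = 1 := by rw [add_conj, hre]; norm_num
  set b := (1 - (s : ℂ)) / conj D with hb
  have hbD : b * conj D = 1 - s := div_mul_cancel₀ _ hDc
  -- `dω³ + b dω̄³ = α ∧ β` for the forms `α, β` below reduces to this identity
  have hbb : (1 - b) * (D - b * conj D) = b := by
    apply mul_right_cancel₀ hDc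
    linear_combination (conj D) * hbD - b * (conj D) * hDs + hDD + (b * conj D - 1 - s) * hbD
      - conj D * hbD
  have hbn : ‖b‖ < 1 := by
    have hpos : 0 < normSq D := normSq_pos.mpr hD
    have h1s : s < 1 := by nlinarith
    rw [← sq_lt_one_iff₀ (norm_nonneg _), ← normSq_eq_norm_sq, hb, map_div₀, normSq_conj,
      show (1 : ℂ) - s = ((1 - s : ℝ) : ℂ) by push_cast; rfl, normSq_ofReal,
      div_lt_one hpos]
    nlinarith
  have hfix : ∀ w : ℂ, ‖w‖ = ‖b‖ * ‖w‖ → w = 0 := by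
    intro w hw
    by_contra hne
    have := norm_pos_iff.mpr hne
    nlinarith
  have hcb : conj b * D = 1 - s := by
    have := congrArg conj hbD
    simpa using this
  let c : (L →ₗ[ℝ] ℂ) → L →ₗ[ℝ] ℂ := fun f => conjAe.toLinearMap ∘ₗ f
  have hc : ∀ f u, c f u = conj (f u) := fun f u => rfl
  refine hasRealEquations_of_complex_heisenberg hdim (z 0 - (D - b * conj D) • c (z 1))
    (z 1 + (1 - b) • c (z 0)) (z 2 + b • c (z 2)) (fun u e0 e1 e2 => ?_) (fun u v => ?_)
    (fun u v => ?_) (fun u v => ?_)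
  · simp only [LinearMap.sub_apply, LinearMap.add_apply, LinearMap.smul_apply, hc,
      smul_eq_mul] at e0 e1 e2
    have e0' := eq_neg_of_add_eq_zero_left e1
    have n0 : ‖z 0 u‖ = ‖D - b * conj D‖ * ‖z 1 u‖ := by
      rw [sub_eq_zero.mp e0, norm_mul, RCLike.norm_conj]
    have n1 : ‖z 1 u‖ = ‖1 - b‖ * ‖z 0 u‖ := by
      rw [e0', norm_neg, norm_mul, RCLike.norm_conj]
    have n2 : ‖z 2 u‖ = ‖b‖ * ‖z 2 u‖ := by
      conv_lhs => rw [eq_neg_of_add_eq_zero_left e2, norm_neg, norm_mul, RCLike.norm_conj]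
    have nb : ‖b‖ = ‖1 - b‖ * ‖D - b * conj D‖ := by rw [← norm_mul, hbb]
    have q0 : z 0 u = 0 := hfix _ (by rw [nb, mul_assoc, mul_left_comm, ← n1, ← n0])
    refine hz.eq_zero u fun i => ?_
    fin_cases i
    exacts [q0, by simpa [q0] using e0', hfix _ n2]
  · simp [hc, h0, h1]
  · simp [hc, h0, h1]
  · simp only [LinearMap.sub_apply, LinearMap.add_apply, LinearMap.smul_apply, hc,
      smul_eq_mul, h2, twoForm, map_neg, map_add, map_sub, map_mul, conj_conj, map_one, map_zero]
    linear_combination (conj (z 0 u) * conj (z 1 v) - conj (z 0 v) * conj (z 1 u)) * hbb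

/-- The change of coframe `ω¹ = a η¹ + b η²`, `ω² = c η¹ + d η²`, `η³ = k ω³`. -/
theorem HasCoframe.transform {J : L →ₗ[ℝ] L} {ρ A B C D : ℂ} (h : HasCoframe J ρ A B C D)
    {k a b c d : ℂ} (hk : k ≠ 0) (hdet : a * d - b * c ≠ 0) {ρ' A' B' C' D' : ℂ}
    (hρ : ρ' = k * ρ * (a * d - b * c))
    (hA : A' = k * (A * a * conj a + B * a * conj c + C * c * conj a + D * c * conj c))
    (hB : B' = k * (A * a * conj b + B * a * conj d + C * c * conj b + D * c * conj d))
    (hC : C' = k * (A * b * conj a + B * b * conj c + C * d * conj a + D * d * conj c))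
    (hD : D' = k * (A * b * conj b + B * b * conj d + C * d * conj b + D * d * conj d)) :
    HasCoframe J ρ' A' B' C' D' := by
  obtain ⟨z, hz, h0, h1, h2⟩ := h
  set Δ := a * d - b * c with hΔ
  set w0 := (d / Δ) • z 0 - (b / Δ) • z 1 with hw0
  set w1 := (a / Δ) • z 1 - (c / Δ) • z 0 with hw1
  have e0 : ∀ u, z 0 u = a * w0 u + b * w1 u := fun u => by
    simp only [hw0, hw1, LinearMap.sub_apply, LinearMap.smul_apply, smul_eq_mul]
    field_simp
    rw [hΔ]; ring
  have e1 : ∀ u, z 1 u = c * w0 u + d * w1 u := fun u => by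
    simp only [hw0, hw1, LinearMap.sub_apply, LinearMap.smul_apply, smul_eq_mul]
    field_simp
    rw [hΔ]; ring
  refine ⟨![w0, w1, k • z 2], ⟨fun i u => ?_, fun u hu => hz.eq_zero u fun i => ?_⟩,
    fun u v => ?_, fun u v => ?_, fun u v => ?_⟩
  · fin_cases i <;> simp [hw0, hw1, hz.type_one_zero] <;> ring
  · have q0 : w0 u = 0 := hu 0
    have q1 : w1 u = 0 := hu 1
    have q2 : k * z 2 u = 0 := hu 2
    fin_cases i
    · simp [e0, q0, q1]
    · simp [e1, q0, q1]
    · simpa [hk] using q2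
  · simp [hw0, h0, h1]
  · simp [hw1, h0, h1]
  · change k * z 2 ⁅u, v⁆ = -twoForm ρ' A' B' C' D' (w0 u) (w1 u) (w0 v) (w1 v)
    rw [h2, e0, e0, e1, e1]
    simp only [twoForm, hρ, hA, hB, hC, hD, map_add, map_mul]
    ring

end

/-! ### Normal forms of the complex structure equations -/

section

variable {L : Type*} [LieRing L] [LieAlgebra ℝ L] {J : L →ₗ[ℝ] L}

/-- The condition on the structure constants of a coframe for the existence of an invariant
pluriclosed metric. -/
def PluriclosedCoeff (ρ A B C D : ℂ) : Prop :=
  normSq ρ + normSq B + normSq C = 2 * (A * conj D).re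

theorem pluriclosedCoeff_iff {ρ A B C D : ℂ} : PluriclosedCoeff ρ A B C D ↔
    ρ * conj ρ + B * conj B + C * conj C - A * conj D - D * conj A = 0 := by
  have e : A * conj D + D * conj A = ((2 * (A * conj D).re : ℝ) : ℂ) := by
    rw [← add_conj]; simp [mul_comm]
  rw [PluriclosedCoeff, mul_conj, mul_conj, mul_conj, sub_sub, e, sub_eq_zero]
  norm_cast

theorem PluriclosedCoeff.transform {ρ A B C D : ℂ} (h : PluriclosedCoeff ρ A B C D)
    {k a b c d : ℂ} {ρ' A' B' C' D' : ℂ}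
    (hρ : ρ' = k * ρ * (a * d - b * c))
    (hA : A' = k * (A * a * conj a + B * a * conj c + C * c * conj a + D * c * conj c))
    (hB : B' = k * (A * a * conj b + B * a * conj d + C * c * conj b + D * c * conj d))
    (hC : C' = k * (A * b * conj a + B * b * conj c + C * d * conj a + D * d * conj c))
    (hD : D' = k * (A * b * conj b + B * b * conj d + C * d * conj b + D * d * conj d)) :
    PluriclosedCoeff ρ' A' B' C' D' := by
  rw [pluriclosedCoeff_iff] at h ⊢
  simp only [hρ, hA, hB, hC, hD, map_add, map_sub, map_mul, conj_conj]
  linear_combination k * conj k * (a * d - b * c) * (conj a * conj d - conj b * conj c) * h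

/-- A sesquilinear form on `ℂ²` in the shape `[1, B; 0, D]` is diagonalisable when its Hermitian
part is positive definite. The pluriclosed condition gives `2 Re D ≥ |B|²`, hence positivity. The
first vector `(x̄, 1)` of the new basis is chosen such that its left and right orthogonal spaces
agree, which is a quadratic equation for `x`. -/
theorem exists_diagonal {ρ B D : ℂ} (h : HasCoframe J ρ 1 B 0 D)
    (hp : PluriclosedCoeff ρ 1 B 0 D) (hB : B ≠ 0) :
    ∃ ρ' D', HasCoframe J ρ' 1 0 0 D' ∧ PluriclosedCoeff ρ' 1 0 0 D' := by
  obtain ⟨s, hs⟩ := IsAlgClosed.exists_pow_nat_eq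
    (discrim (conj B) (B * conj B + conj D - D) (conj D * B)) (n := 2) (by norm_num)
  have hBc : conj B ≠ 0 := by simpa using hB
  obtain ⟨x, hx⟩ := exists_quadratic_eq_zero hBc ⟨s, by rw [← hs, sq]⟩
  -- the value of the form on the first vector of the new basis has positive real part
  have hpos : 0 < (conj x * x + B * conj x + D).re := by
    have hp' : normSq ρ + normSq B = 2 * D.re := by simpa [PluriclosedCoeff] using hp
    have hρ := normSq_nonneg ρ
    have hBpos := normSq_pos.mpr hB
    have e : (conj x * x + B * conj x + D).re = normSq (x + B / 2) + D.re - normSq B / 4 := by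
      simp [normSq_apply]
      ring
    have := normSq_nonneg (x + B / 2)
    rw [e]; linarith
  set N := conj x * x + B * conj x + D with hN
  have hN0 : N ≠ 0 := by
    intro h0
    rw [h0] at hpos
    simp at hpos
  have hdet : conj x * x - -(conj B * x + conj D) * 1 ≠ 0 := by
    have : conj x * x - -(conj B * x + conj D) * 1 = conj N := by
      rw [hN]; simp only [map_add, map_mul, conj_conj]; ring
    rw [this]; simpa using hN0
  have hk : N⁻¹ ≠ 0 := inv_ne_zero hN0
  have hA : (1 : ℂ) = N⁻¹ * (1 * conj x * conj (conj x) + B * conj x * conj 1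
      + 0 * 1 * conj (conj x) + D * 1 * conj 1) := by
    rw [conj_conj, map_one]
    field_simp
    rw [hN]; ring
  have hB' : (0 : ℂ) = N⁻¹ * (1 * conj x * conj (-(conj B * x + conj D)) + B * conj x * conj x
      + 0 * 1 * conj (-(conj B * x + conj D)) + D * 1 * conj x) := by
    simp only [map_neg, map_add, map_mul, conj_conj]; ring
  have hC : (0 : ℂ) = N⁻¹ * (1 * -(conj B * x + conj D) * conj (conj x)
      + B * -(conj B * x + conj D) * conj 1 + 0 * x * conj (conj x) + D * x * conj 1) := by
    rw [conj_conj, map_one]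
    linear_combination N⁻¹ * hx
  exact ⟨_, _, h.transform hk hdet rfl hA hB' hC rfl, hp.transform rfl hA hB' hC rfl⟩

/-- The normal forms of the structure constants, for a pluriclosed metric. -/
theorem HasCoframe.normal_form {ρ A B C D : ℂ} (h : HasCoframe J ρ A B C D)
    (hp : PluriclosedCoeff ρ A B C D) :
    HasCoframe J 0 0 0 0 0 ∨ HasCoframe J 0 1 0 0 I ∨
    (∃ D, D.re = 1 ∧ 0 < D.im ∧ HasCoframe J 1 1 1 0 D) ∨ HasCoframe J 1 1 1 0 1 ∨
    (∃ y : ℝ, 0 < y ∧ 4 * y ^ 2 < 3 ∧ HasCoframe J 1 1 0 0 (1 / 2 + I * y)) ∨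
    HasCoframe J 1 1 0 0 (1 / 2) ∨ HasCoframe J 0 1 0 0 0 := by
  -- either `dω³ = 0` or one of the two diagonal coefficients can be normalised to `1`
  have step1 : HasCoframe J 0 0 0 0 0 ∨ ∃ ρ B C D, HasCoframe J ρ 1 B C D ∧
      PluriclosedCoeff ρ 1 B C D := by
    by_cases hA : A = 0
    · by_cases hD : D = 0
      · left
        subst hA hD
        have hp' : normSq ρ + normSq B + normSq C = 0 := by simpa [PluriclosedCoeff] using hp
        have n1 := normSq_nonneg ρ
        have n2 := normSq_nonneg B
        have n3 := normSq_nonneg C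
        obtain rfl : ρ = 0 := normSq_eq_zero.mp (by linarith)
        obtain rfl : B = 0 := normSq_eq_zero.mp (by linarith)
        obtain rfl : C = 0 := normSq_eq_zero.mp (by linarith)
        exact h
      · right
        have e : (1 : ℂ) = D⁻¹ * (A * 0 * conj 0 + B * 0 * conj 1 + C * 1 * conj 0
            + D * 1 * conj 1) := by simp [hD]
        exact ⟨_, _, _, _, h.transform (k := D⁻¹) (a := 0) (b := 1) (c := 1) (d := 0)
          (inv_ne_zero hD) (by simp) rfl e rfl rfl rfl, hp.transform rfl e rfl rfl rfl⟩
    · right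
      have e : (1 : ℂ) = A⁻¹ * (A * 1 * conj 1 + B * 1 * conj 0 + C * 0 * conj 1
            + D * 0 * conj 0) := by simp [hA]
      exact ⟨_, _, _, _, h.transform (k := A⁻¹) (a := 1) (b := 0) (c := 0) (d := 1)
          (inv_ne_zero hA) (by simp) rfl e rfl rfl rfl, hp.transform rfl e rfl rfl rfl⟩
  clear h hp
  obtain h | ⟨ρ, B, C, D, h, hp⟩ := step1
  · exact Or.inl h
  right
  -- complete the square
  have step2 : ∃ ρ B D, HasCoframe J ρ 1 B 0 D ∧ PluriclosedCoeff ρ 1 B 0 D := by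
    have e : (1 : ℂ) = 1 * (1 * 1 * conj 1 + B * 1 * conj 0 + C * 0 * conj 1
            + D * 0 * conj 0) := by simp
    have e' : (0 : ℂ) = 1 * (1 * -C * conj 1 + B * -C * conj 0 + C * 1 * conj 1
            + D * 1 * conj 0) := by simp
    exact ⟨_, _, _, h.transform (k := 1) (a := 1) (b := -C) (c := 0) (d := 1) one_ne_zero (by simp)
      rfl e rfl e' rfl, hp.transform rfl e rfl e' rfl⟩
  clear h hp
  obtain ⟨ρ, B, D, h, hp⟩ := step2
  have step3 : ∃ ρ D, HasCoframe J ρ 1 0 0 D ∧ PluriclosedCoeff ρ 1 0 0 D := by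
    by_cases hB : B = 0
    · subst hB; exact ⟨_, _, h, hp⟩
    · exact exists_diagonal h hp hB
  clear h hp
  obtain ⟨ρ, D, h, hp⟩ := step3
  have hp' : normSq ρ = 2 * D.re := by simpa [PluriclosedCoeff] using hp
  by_cases hρ : ρ = 0
  · subst hρ
    have hre : D.re = 0 := by simpa using hp'.symm
    have hD : D = I * D.im := by
      apply Complex.ext <;> simp [hre]
    rcases lt_trichotomy D.im 0 with him | him | him
    · left
      have hD0 : D ≠ 0 := by rintro rfl; simp at him
      have hs : ((Real.sqrt (-D.im) : ℝ) : ℂ) ^ 2 = -D.im := by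
        exact_mod_cast Real.sq_sqrt (by linarith : 0 ≤ -D.im)
      have hs0 : ((Real.sqrt (-D.im) : ℝ) : ℂ) ≠ 0 := by
        exact_mod_cast (Real.sqrt_pos.mpr (by linarith)).ne'
      have him0 : (D.im : ℂ) ≠ 0 := by exact_mod_cast him.ne
      refine h.transform (k := D⁻¹) (a := 0) (b := (Real.sqrt (-D.im) : ℝ)) (c := 1) (d := 0)
        (inv_ne_zero hD0) (by simpa using hs0) (by simp) (by simp [hD0]) (by simp) (by simp) ?_
      simp only [conj_ofReal]
      rw [eq_inv_mul_iff_mul_eq₀ hD0]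
      linear_combination -hs + I * hD + (D.im : ℂ) * I_sq
    · right; right; right; right; right
      have : D = 0 := by rw [hD, him]; simp
      rwa [this] at h
    · left
      have hs : ((Real.sqrt D.im : ℝ) : ℂ) ^ 2 = D.im := by
        exact_mod_cast Real.sq_sqrt him.le
      have hs0 : ((Real.sqrt D.im : ℝ) : ℂ) ≠ 0 := by
        exact_mod_cast (Real.sqrt_pos.mpr him).ne'
      refine h.transform (k := 1) (a := 1) (b := 0) (c := 0) (d := ((Real.sqrt D.im : ℝ) : ℂ)⁻¹)
        one_ne_zero (by simpa using hs0) (by simp) (by simp) (by simp) (by simp) ?_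
      simp only [map_inv₀, conj_ofReal]
      field_simp
      rw [hs]
      linear_combination -hD
  -- now `ρ ≠ 0`: normalise it to `1`, then make `Im D` nonnegative by exchanging `ω¹` and `ω²`
  have step4 : ∃ D, HasCoframe J 1 1 0 0 D ∧ D.re = 1 / 2 := by
    have e : (1 : ℂ) = 1 * ρ * (1 * ρ⁻¹ - 0 * 0) := by simp [hρ]
    refine ⟨_, h.transform (k := 1) (a := 1) (b := 0) (c := 0) (d := ρ⁻¹) one_ne_zero
      (by simpa using hρ) e (by simp) (by simp) (by simp) rfl, ?_⟩
    have hn := normSq_pos.mpr hρ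
    have : (1 : ℂ) * (1 * 0 * conj 0 + 0 * 0 * conj ρ⁻¹ + 0 * ρ⁻¹ * conj 0 + D * ρ⁻¹ * conj ρ⁻¹) =
        ((normSq ρ)⁻¹ : ℝ) * D := by
      rw [← normSq_inv, ← mul_conj]; ring
    rw [this, re_ofReal_mul]
    field_simp
    linarith
  clear h hp hp' hρ
  obtain ⟨D, h, hre⟩ := step4
  have step5 : ∃ D, HasCoframe J 1 1 0 0 D ∧ D.re = 1 / 2 ∧ 0 ≤ D.im := by
    by_cases him : 0 ≤ D.im
    · exact ⟨D, h, hre, him⟩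
    have hD0 : D ≠ 0 := by rintro rfl; simp at him
    refine ⟨conj D, h.transform (k := D⁻¹) (a := 0) (b := -D) (c := 1) (d := 0)
      (inv_ne_zero hD0) (by simpa using hD0) (by simp [hD0]) (by simp [hD0]) (by simp) (by simp)
      (by simp [hD0]), by simpa using hre, ?_⟩
    rw [conj_im]; linarith
  clear h hre
  obtain ⟨D, h, hre, him⟩ := step5
  set y := D.im with hy
  have hD : D = 1 / 2 + I * y := by
    apply Complex.ext <;> simp [hre, hy]
  rcases him.eq_or_lt with h0 | hypos
  · right; right; right; right; left
    rw [← h0] at hD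
    simpa [hD] using h
  rcases lt_or_ge (4 * y ^ 2) 3 with hlt | hge
  · right; right; right; left
    exact ⟨y, hypos, hlt, hD ▸ h⟩
  -- the remaining `D` have an equivalent normal form with `ω^{1 2̄}`; `X` is the squared modulus
  -- of the off-diagonal entry of the base change
  set s := Real.sqrt (16 * y ^ 4 - 12 * y ^ 2) with hs
  have hs2 : s ^ 2 = 16 * y ^ 4 - 12 * y ^ 2 := Real.sq_sqrt (by nlinarith [sq_nonneg y])
  have hs0 : 0 ≤ s := Real.sqrt_nonneg _
  set m := 1 / 4 + y ^ 2 with hm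
  have hm0 : 0 < m := by positivity
  set X := (4 * y ^ 2 - 1 - s) / (2 * m) with hX
  have hX2 : 2 * m * X = 4 * y ^ 2 - 1 - s := by rw [hX]; field_simp
  have hquad : m * X ^ 2 + (1 - 4 * y ^ 2) * X + 1 = 0 := by
    have : (4 * m) * (m * X ^ 2 + (1 - 4 * y ^ 2) * X + 1) = 0 := by
      have e : (2 * m * X) ^ 2 = (4 * y ^ 2 - 1 - s) ^ 2 := by rw [hX2]
      linear_combination e + 2 * (1 - 4 * y ^ 2) * hX2 + hs2 + 4 * hm
    rcases mul_eq_zero.mp this with h1 | h1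
    · linarith
    · exact h1
  have hmX : m * X ^ 2 ≤ 1 := by
    have hsle : s ≤ 4 * y ^ 2 - 1 := by nlinarith
    have : 4 * m * (m * X ^ 2) ≤ 4 * m := by
      have e : 4 * m * (m * X ^ 2) = (4 * y ^ 2 - 1 - s) ^ 2 := by rw [← hX2]; ring
      have e2 : 4 * m = (4 * y ^ 2 - 1 - s) * (4 * y ^ 2 - 1 + s) := by
        rw [hm]; linear_combination hs2
      rw [e]; nlinarith
    nlinarith
  set N : ℂ := 1 + D * X with hN
  have hNN : normSq N = 4 * y ^ 2 * X := by
    rw [hN, normSq_apply]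
    simp [hre, ← hy]
    linear_combination hquad - X ^ 2 * hm
  have hN0 : N ≠ 0 := by
    intro h0
    rw [h0, map_zero] at hNN
    have hX0 : X = 0 := by
      rcases mul_eq_zero.mp hNN.symm with h1 | h1
      · nlinarith
      · exact h1
    rw [hN, hX0] at h0
    simp at h0
  have hyc : (y : ℂ) ≠ 0 := by exact_mod_cast hypos.ne'
  set r : ℂ := N / (2 * I * y) with hr
  have hrN : 2 * I * y * r = N := by rw [hr]; field_simp
  have hrr : r * conj r = X := by
    rw [mul_conj, hr, normSq_div, hNN]
    simp [normSq_apply]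
    field_simp
    norm_num
    ring
  have hDD : D - conj D = 2 * I * y := by
    rw [hD]; simp [map_ofNat]; ring
  have hdet : 1 * 1 - -D * conj r * r ≠ 0 := by
    rwa [show 1 * 1 - -D * conj r * r = N by rw [hN, ← hrr]; ring]
  have hk : N⁻¹ ≠ 0 := inv_ne_zero hN0
  have hρ' : (1 : ℂ) = N⁻¹ * 1 * (1 * 1 - -D * conj r * r) := by
    rw [show 1 * 1 - -D * conj r * r = N by rw [hN, ← hrr]; ring]
    field_simp
  have hA' : (1 : ℂ) = N⁻¹ * (1 * 1 * conj 1 + 0 * 1 * conj r + 0 * r * conj 1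
      + D * r * conj r) := by
    rw [mul_assoc D, hrr]
    simp only [map_one]
    field_simp
    rw [hN]; ring
  have hB' : (1 : ℂ) = N⁻¹ * (1 * 1 * conj (-D * conj r) + 0 * 1 * conj 1
      + 0 * r * conj (-D * conj r) + D * r * conj 1) := by
    simp only [map_neg, map_mul, conj_conj, map_one]
    field_simp
    linear_combination -hrN - r * hDD
  have hC' : (0 : ℂ) = N⁻¹ * (1 * (-D * conj r) * conj 1 + 0 * (-D * conj r) * conj r
      + 0 * 1 * conj 1 + D * 1 * conj r) := by
    simp only [map_one]; ring
  have hp : PluriclosedCoeff 1 1 0 0 D := by simp [PluriclosedCoeff, hre]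
  have h' := h.transform hk hdet hρ' hA' hB' hC' rfl
  have hp' := hp.transform hρ' hA' hB' hC' rfl
  set D' := N⁻¹ * (1 * (-D * conj r) * conj (-D * conj r) + 0 * (-D * conj r) * conj 1 +
    0 * 1 * conj (-D * conj r) + D * 1 * conj 1) with hD'
  have hre' : D'.re = 1 := by
    have : 1 + 1 = 2 * D'.re := by simpa [PluriclosedCoeff] using hp'
    linarith
  have him' : 0 ≤ D'.im := by
    have e : D' = ((normSq N)⁻¹ : ℝ) * (D * conj N * conj N) := by
      have e1 : (((normSq N)⁻¹ : ℝ) : ℂ) = N⁻¹ * (conj N)⁻¹ := by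
        rw [← mul_inv, mul_conj]; push_cast; rfl
      have hNc : conj N ≠ 0 := by simpa using hN0
      rw [e1, hD']
      field_simp
      simp only [map_neg, map_mul, conj_conj, map_one, hN, map_add, conj_ofReal]
      linear_combination D * conj D * hrr
    have e2 : (D * conj N * conj N).im = y * (1 - m * X ^ 2) := by
      rw [hN]
      simp [hre, ← hy]
      rw [hm]; ring
    rw [e, im_ofReal_mul, e2]
    exact mul_nonneg (inv_nonneg.mpr (normSq_nonneg _)) (mul_nonneg hypos.le (by linarith))
  rcases him'.eq_or_lt with h0 | hpos
  · right; right; left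
    have : D' = 1 := Complex.ext (by simpa using hre') (by simpa using h0.symm)
    rwa [this] at h'
  · right; left
    exact ⟨D', hre', hpos, h'⟩

end

/-! ### The metric defined by a coframe -/

section

variable {L : Type*} [LieRing L] [LieAlgebra ℝ L] {J : L →ₗ[ℝ] L}

/-- The Hermitian inner product for which the coframe `z` is unitary. -/
def coframeMetric (z : Fin 3 → L →ₗ[ℝ] ℂ) : L →ₗ[ℝ] L →ₗ[ℝ] ℝ :=
  LinearMap.mk₂ ℝ (fun u v => ∑ i, (z i u * conj (z i v)).re)
    (fun u u' v => by simp only [map_add, add_mul, add_re, Finset.sum_add_distrib])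
    (fun c u v => by
      rw [smul_eq_mul, Finset.mul_sum]
      refine Finset.sum_congr rfl fun i _ => ?_
      simp; ring)
    (fun u v v' => by simp only [map_add, mul_add, add_re, Finset.sum_add_distrib])
    (fun c u v => by
      rw [smul_eq_mul, Finset.mul_sum]
      refine Finset.sum_congr rfl fun i _ => ?_
      simp; ring)

theorem coframeMetric_apply (z : Fin 3 → L →ₗ[ℝ] ℂ) (u v : L) :
    coframeMetric z u v = ∑ i, (z i u * conj (z i v)).re := rfl

theorem IsCoframe.isHermitianPair {z : Fin 3 → L →ₗ[ℝ] ℂ} (hz : IsCoframe J z)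
    (hsq : ∀ u, J (J u) = -u) (hN : ∀ u v : L, ⁅J u, J v⁆ = J ⁅J u, v⁆ + J ⁅u, J v⁆ + ⁅u, v⁆) :
    IsHermitianPair J (coframeMetric z) where
  sq := hsq
  nijenhuis := hN
  symm u v := by
    simp only [coframeMetric_apply]
    refine Finset.sum_congr rfl fun i _ => ?_
    rw [← conj_re, map_mul, conj_conj, mul_comm]
  pos v hv := by
    simp only [coframeMetric_apply, mul_conj, ofReal_re]
    obtain ⟨i, hi⟩ : ∃ i, z i v ≠ 0 := by
      by_contra! hall
      exact hv (hz.eq_zero v hall)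
    exact Finset.sum_pos' (fun i _ => normSq_nonneg _) ⟨i, Finset.mem_univ _, normSq_pos.mpr hi⟩
  hermitian u v := by
    simp only [coframeMetric_apply, hz.type_one_zero]
    refine Finset.sum_congr rfl fun i _ => ?_
    rw [map_mul, conj_I]
    congr 1
    linear_combination -(z i u * conj (z i v)) * I_sq

theorem twoForm_I_mul (ρ A B C D p q p' q' : ℂ) :
    twoForm ρ A B C D (I * p) (I * q) (I * p') (I * q') = twoForm (-ρ) A B C D p q p' q' := by
  simp only [twoForm, map_mul, conj_I]
  ring_nf
  simp only [I_sq]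
  ring

/-- For a coframe with closed `ω¹, ω²`, the form `d(torsion)` is, up to sign, the real part of
`dω³ ∧ dω̄³`, a multiple of the volume form of `ω¹, ω²`. -/
theorem IsCoframe.dTorsion_eq_zero {z : Fin 3 → L →ₗ[ℝ] ℂ} (hz : IsCoframe J z)
    {ρ A B D : ℂ} (h0 : ∀ u v : L, z 0 ⁅u, v⁆ = 0) (h1 : ∀ u v : L, z 1 ⁅u, v⁆ = 0)
    (h2 : ∀ u v : L, z 2 ⁅u, v⁆ = -twoForm ρ A B 0 D (z 0 u) (z 1 u) (z 0 v) (z 1 v))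
    (hp : PluriclosedCoeff ρ A B 0 D) (a b c d : L) :
    dTorsion J (coframeMetric z) a b c d = 0 := by
  have ht : ∀ a b c d : L, torsion J (coframeMetric z) ⁅a, b⁆ c d =
      (twoForm (-ρ) A B 0 D (z 0 c) (z 1 c) (z 0 d) (z 1 d) *
        conj (twoForm ρ A B 0 D (z 0 a) (z 1 a) (z 0 b) (z 1 b))).re := by
    intro a b c d
    have e1 : z 2 ⁅J ⁅a, b⁆, J c⁆ = 0 := by
      rw [h2, hz.type_one_zero, hz.type_one_zero, h0, h1]; simp [twoForm]
    have e2 : z 2 ⁅J d, J ⁅a, b⁆⁆ = 0 := by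
      rw [h2, hz.type_one_zero 0 ⁅a, b⁆, hz.type_one_zero 1 ⁅a, b⁆, h0, h1]; simp [twoForm]
    simp only [torsion, coframeMetric_apply, Fin.sum_univ_three, h0, h1, e1, e2, h2 (J c), h2 a b,
      hz.type_one_zero _ c, hz.type_one_zero _ d, twoForm_I_mul, map_neg, neg_mul_neg]
    simp
  have hre : ∀ x y : ℂ, (((x * conj y).re : ℝ) : ℂ) = (x * conj y + conj x * y) / 2 := by
    intro x y
    rw [re_eq_add_conj, map_mul, conj_conj]
  have hp' := pluriclosedCoeff_iff.mp hp
  rw [← ofReal_eq_zero]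
  simp only [dTorsion, ht]
  simp only [ofReal_add, ofReal_sub, ofReal_neg, hre]
  generalize z 0 a = p₁, z 0 b = p₂, z 0 c = p₃, z 0 d = p₄, z 1 a = q₁, z 1 b = q₂, z 1 c = q₃,
    z 1 d = q₄
  simp only [twoForm, map_neg, map_add, map_sub, map_mul, conj_conj, zero_mul, add_zero]
  -- the coefficient is the determinant with rows `p`, `p̄`, `q`, `q̄`
  linear_combination -(p₁ * (conj p₂ * q₃ * conj q₄ - conj p₂ * q₄ * conj q₃
        - conj p₃ * q₂ * conj q₄ + conj p₃ * q₄ * conj q₂ + conj p₄ * q₂ * conj q₃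
        - conj p₄ * q₃ * conj q₂)
      - p₂ * (conj p₁ * q₃ * conj q₄ - conj p₁ * q₄ * conj q₃ - conj p₃ * q₁ * conj q₄
        + conj p₃ * q₄ * conj q₁ + conj p₄ * q₁ * conj q₃ - conj p₄ * q₃ * conj q₁)
      + p₃ * (conj p₁ * q₂ * conj q₄ - conj p₁ * q₄ * conj q₂ - conj p₂ * q₁ * conj q₄
        + conj p₂ * q₄ * conj q₁ + conj p₄ * q₁ * conj q₂ - conj p₄ * q₂ * conj q₁)
      - p₄ * (conj p₁ * q₂ * conj q₃ - conj p₁ * q₃ * conj q₂ - conj p₂ * q₁ * conj q₃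
        + conj p₂ * q₃ * conj q₁ + conj p₃ * q₁ * conj q₂ - conj p₃ * q₂ * conj q₁)) * hp'

end

/-! ### Metrics and coframes on the group -/

section

/-- On a real vector space of dimension `6` with complex structure `J`, three `(1,0)`-forms
are linearly independent over `ℂ` if and only if their only common zero is `0`. -/
theorem linearIndependent_iff_eq_zero {V : Type*} [AddCommGroup V] [Module ℝ V]
    (hdim : Module.finrank ℝ V = 6) {J : V → V} {z : Fin 3 → V →ₗ[ℝ] ℂ}
    (hz : ∀ i u, z i (J u) = I * z i u) :
    LinearIndependent ℂ z ↔ ∀ u, (∀ i, z i u = 0) → u = 0 := by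
  have : FiniteDimensional ℝ V := Module.finite_of_finrank_pos (by omega)
  have hfr : Module.finrank ℝ V = Module.finrank ℝ (Fin 3 → ℂ) := by
    rw [hdim, Module.finrank_pi_fintype]
    simp [Complex.finrank_real_complex]
  have hinj : (∀ u, (∀ i, z i u = 0) → u = 0) ↔ Function.Surjective (LinearMap.pi z) := by
    rw [← LinearMap.injective_iff_surjective_of_finrank_eq_finrank hfr,
      injective_iff_map_eq_zero]
    simp only [funext_iff, LinearMap.pi_apply, Pi.zero_apply]
  rw [hinj]
  constructor
  · intro hli
    -- The range is stable under `I`; a proper complex subspace would give a linear relation.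
    let R : Submodule ℂ (Fin 3 → ℂ) :=
      { (LinearMap.range (LinearMap.pi z)).toAddSubmonoid with
        smul_mem' := by
          rintro c _ ⟨u, rfl⟩
          refine ⟨c.re • u + c.im • J u, ?_⟩
          ext1 i
          simp only [LinearMap.pi_apply, map_add, map_smul, hz, Pi.smul_apply, real_smul,
            smul_eq_mul]
          conv_rhs => rw [← re_add_im c]
          ring }
    by_contra hsurj
    have hlt : R < ⊤ := by
      refine lt_top_iff_ne_top.mpr fun htop => hsurj fun w => ?_
      have : w ∈ R := htop ▸ Submodule.mem_top
      exact this
    obtain ⟨f, hf0, hf⟩ := Submodule.exists_le_ker_of_lt_top R hlt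
    refine hf0 (LinearMap.pi_ext' fun i => LinearMap.ext_ring ?_)
    have hrel : ∑ i, f (Pi.single i 1) • z i = 0 := by
      ext1 u
      have hu : f (LinearMap.pi z u) = 0 := hf ⟨u, rfl⟩
      rw [← Finset.univ_sum_single (LinearMap.pi z u), map_sum] at hu
      rw [LinearMap.sum_apply, LinearMap.zero_apply, ← hu]
      refine Finset.sum_congr rfl fun i _ => ?_
      rw [LinearMap.smul_apply, smul_eq_mul, mul_comm, ← smul_eq_mul, ← map_smul, ← Pi.single_smul,
        smul_eq_mul, mul_one, LinearMap.pi_apply]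
    exact Fintype.linearIndependent_iff.mp hli _ hrel i
  · intro hsurj
    refine Fintype.linearIndependent_iff.mpr fun c hc i => ?_
    obtain ⟨u, hu⟩ := hsurj (Pi.single i 1)
    have hu' : ∀ j, z j u = (Pi.single i 1 : Fin 3 → ℂ) j := fun j => congrFun hu j
    have := LinearMap.congr_fun hc u
    simpa [LinearMap.sum_apply, hu', Pi.single_apply] using this

theorem ceDer_one {L : Type*} [Bracket L L] (z : L → ℂ) :
    ceDer (fun v : Fin 1 → L => z (v 0)) = fun v => -z ⁅v 0, v 1⁆ := by
  ext v
  simp [ceDer]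

section Group
variable {G : Type*} [TopologicalSpace G] [ChartedSpace (EuclideanSpace ℝ (Fin 6)) G]
    [Group G]

theorem finrank_groupLieAlgebra : Module.finrank ℝ (GroupLieAlgebra (𝓡 6) G) = 6 :=
  finrank_euclideanSpace_fin

variable [LieGroup (𝓡 6) ∞ G] (𝒥 : LeftInvariantComplexStructure G)

theorem nijenhuis_atOne (u v : GroupLieAlgebra (𝓡 6) G) :
    ⁅𝒥.atOne u, 𝒥.atOne v⁆ = 𝒥.atOne ⁅𝒥.atOne u, v⁆ + 𝒥.atOne ⁅u, 𝒥.atOne v⁆ + ⁅u, v⁆ := by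
  have := atOne_nijenhuis 𝒥 u v
  rw [sub_eq_zero, sub_eq_iff_eq_add, sub_eq_iff_eq_add] at this
  rw [this]
  abel

theorem del_leftInvForm {k : ℕ} (φ : (Fin (k + 1) → GroupLieAlgebra (𝓡 6) G) → ℂ) :
    del 𝒥 (leftInvForm φ) = leftInvForm (ceDel 𝒥.atOne φ) := by
  simp only [del, ceDel, typeComponent_leftInvForm, extDer_leftInvForm, sum_leftInvForm]

theorem delbar_leftInvForm {k : ℕ} (φ : (Fin (k + 1) → GroupLieAlgebra (𝓡 6) G) → ℂ) :
    delbar 𝒥 (leftInvForm φ) = leftInvForm (ceDelbar 𝒥.atOne φ) := by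
  simp only [delbar, ceDelbar, typeComponent_leftInvForm, extDer_leftInvForm, sum_leftInvForm]

variable {𝒥}

theorem LeftInvariantHermitianMetric.g_eq (h : LeftInvariantHermitianMetric 𝒥) (x : G)
    (u v : Tan x) : h.g x u v = h.g 1 (toIdentity x u) (toIdentity x v) := by
  have key : ∀ y : G, y = 1 → ∀ a b : EuclideanSpace ℝ (Fin 6),
      (h.g y : EuclideanSpace ℝ (Fin 6) →ₗ[ℝ] EuclideanSpace ℝ (Fin 6) →ₗ[ℝ] ℝ) a b =
        h.g 1 a b := by
    rintro _ rfl _ _; rfl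
  exact (h.left_inv x⁻¹ x u v).symm.trans (key _ (inv_mul_cancel x) _ _)

theorem LeftInvariantHermitianMetric.isHermitianPair (h : LeftInvariantHermitianMetric 𝒥) :
    IsHermitianPair 𝒥.atOne (h.g 1) where
  sq := atOne_atOne 𝒥
  nijenhuis := nijenhuis_atOne 𝒥
  symm := h.symm 1
  pos := h.pos 1
  hermitian := h.hermitian 1

theorem isPluriclosed_iff (h : LeftInvariantHermitianMetric 𝒥) :
    IsPluriclosed h ↔ ceDel 𝒥.atOne (ceDelbar 𝒥.atOne (fun v : Fin 2 → GroupLieAlgebra (𝓡 6) G =>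
      ((h.g 1 (𝒥.atOne (v 0)) (v 1) : ℝ) : ℂ))) = 0 := by
  have hfund : fundamentalForm h = leftInvForm
      (fun v : Fin 2 → GroupLieAlgebra (𝓡 6) G => ((h.g 1 (𝒥.atOne (v 0)) (v 1) : ℝ) : ℂ)) := by
    ext x v
    simp only [fundamentalForm, leftInvForm, h.g_eq x, toIdentity_J]
  rw [IsPluriclosed, hfund, delbar_leftInvForm, del_leftInvForm, leftInvForm_eq_zero_iff]

/-- The left-invariant metric with a given value at the identity. -/
def metricOfInner (B : GroupLieAlgebra (𝓡 6) G →ₗ[ℝ] GroupLieAlgebra (𝓡 6) G →ₗ[ℝ] ℝ)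
    (hB : IsHermitianPair 𝒥.atOne B) : LeftInvariantHermitianMetric 𝒥 where
  g x := B.compl₁₂ (toIdentityEquiv x).toLinearMap (toIdentityEquiv x).toLinearMap
  symm x u v := hB.symm _ _
  pos x v hv := hB.pos _ ((toIdentityEquiv x).map_ne_zero_iff.mpr hv)
  hermitian x u v := by
    change B (toIdentity x _) (toIdentity x _) = B (toIdentity x _) (toIdentity x _)
    rw [toIdentity_J, toIdentity_J, hB.hermitian]
  left_inv a x u v := by
    change B (toIdentity _ _) (toIdentity _ _) = B (toIdentity x _) (toIdentity x _)
    rw [toIdentity_dLeft, toIdentity_dLeft]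

theorem metricOfInner_g_one (B : GroupLieAlgebra (𝓡 6) G →ₗ[ℝ] GroupLieAlgebra (𝓡 6) G →ₗ[ℝ] ℝ)
    (hB : IsHermitianPair 𝒥.atOne B) (u v : GroupLieAlgebra (𝓡 6) G) :
    (metricOfInner B hB).g 1 u v = B u v := by
  change B (toIdentity 1 u) (toIdentity 1 v) = B u v
  rw [toIdentity_one, toIdentity_one]

theorem isPluriclosed_metricOfInner
    {B : GroupLieAlgebra (𝓡 6) G →ₗ[ℝ] GroupLieAlgebra (𝓡 6) G →ₗ[ℝ] ℝ}
    (hB : IsHermitianPair 𝒥.atOne B) (h0 : ∀ a b c d, dTorsion 𝒥.atOne B a b c d = 0) :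
    IsPluriclosed (metricOfInner B hB) := by
  rw [isPluriclosed_iff]
  simp only [metricOfInner_g_one]
  rw [hB.ceDel_ceDelbar_fund]
  simp only [h0]
  ext v
  simp [typePart]

theorem extDer_oneForm (z : GroupLieAlgebra (𝓡 6) G →ₗ[ℝ] ℂ) :
    extDer (oneForm (fun x : G => z ∘ₗ (toIdentityEquiv x).toLinearMap)) =
      leftInvForm fun v => -z ⁅v 0, v 1⁆ := by
  rw [← ceDer_one, ← extDer_leftInvForm]
  rfl

theorem IsLeftInvariantCoframe.eq_comp {η : Fin 3 → ∀ x : G, Tan x →ₗ[ℝ] ℂ}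
    (hη : IsLeftInvariantCoframe 𝒥 η) (i : Fin 3) :
    η i = fun x : G => (η i 1 : GroupLieAlgebra (𝓡 6) G →ₗ[ℝ] ℂ) ∘ₗ
      (toIdentityEquiv x).toLinearMap := by
  ext x v
  have key : ∀ y : G, y = 1 → ∀ a : EuclideanSpace ℝ (Fin 6),
      (η i y : EuclideanSpace ℝ (Fin 6) →ₗ[ℝ] ℂ) a = η i 1 a := by
    rintro _ rfl _; rfl
  exact (hη.left_inv i x⁻¹ x v).symm.trans (key _ (inv_mul_cancel x) _)

theorem isLeftInvariantCoframe_comp_iff {z : Fin 3 → GroupLieAlgebra (𝓡 6) G →ₗ[ℝ] ℂ} :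
    IsLeftInvariantCoframe 𝒥 (fun i x => z i ∘ₗ (toIdentityEquiv x).toLinearMap) ↔
      IsCoframe 𝒥.atOne z := by
  constructor
  · intro h
    have h1 : ∀ i u, z i (𝒥.atOne u) = I * z i u := fun i u => by
      have := h.type_one_zero i 1 u
      change z i (toIdentity 1 (𝒥.J 1 u)) = I * z i (toIdentity 1 u) at this
      rwa [toIdentity_J, toIdentity_one] at this
    refine ⟨h1, (linearIndependent_iff_eq_zero finrank_groupLieAlgebra h1).mp ?_⟩
    have := h.linearIndependent 1
    have hz : (fun i => z i ∘ₗ (toIdentityEquiv (1 : G)).toLinearMap) = z := by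
      ext i u
      exact congrArg (z i) (toIdentity_one u)
    rwa [hz] at this
  · intro h
    have h1 : ∀ (i : Fin 3) (x : G) (v : Tan x),
        z i (toIdentity x (𝒥.J x v)) = I * z i (toIdentity x v) := fun i x v => by
      rw [toIdentity_J, h.type_one_zero]
    refine ⟨fun i a x v => ?_, h1, fun x => ?_⟩
    · exact congrArg (z i) (toIdentity_dLeft a x v)
    · refine (linearIndependent_iff_eq_zero (V := Tan x) (J := 𝒥.J x)
        finrank_euclideanSpace_fin fun i => h1 i x).mpr fun v hv => ?_
      exact (toIdentityEquiv x).map_eq_zero_iff.mp (h.eq_zero _ hv)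

theorem hasStructureEquations_iff {ρ κ μ D : ℂ} :
    HasStructureEquations 𝒥 ρ κ μ D ↔ HasCoframe 𝒥.atOne ρ κ μ 0 D := by
  have hform : ∀ z : Fin 3 → GroupLieAlgebra (𝓡 6) G →ₗ[ℝ] ℂ,
      let η : Fin 3 → ∀ x : G, Tan x →ₗ[ℝ] ℂ := fun i x => z i ∘ₗ (toIdentityEquiv x).toLinearMap
      ρ • wedge (oneForm (η 0)) (oneForm (η 1))
        + κ • wedge (oneForm (η 0)) (conjForm (oneForm (η 0)))
        + μ • wedge (oneForm (η 0)) (conjForm (oneForm (η 1)))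
        + D • wedge (oneForm (η 1)) (conjForm (oneForm (η 1))) =
      leftInvForm fun v => twoForm ρ κ μ 0 D (z 0 (v 0)) (z 1 (v 0)) (z 0 (v 1)) (z 1 (v 1)) := by
    intro z η
    ext x v
    change ρ * (z 0 (toIdentity x (v 0)) * z 1 (toIdentity x (v 1)) - z 0 (toIdentity x (v 1)) *
        z 1 (toIdentity x (v 0))) + κ * (_ - _) + μ * (_ - _) + D * (_ - _) = _
    simp only [twoForm, leftInvForm, zero_mul, add_zero]
    rfl
  have hiff : ∀ z : Fin 3 → GroupLieAlgebra (𝓡 6) G →ₗ[ℝ] ℂ, ∀ i,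
      extDer (oneForm (fun x : G => z i ∘ₗ (toIdentityEquiv x).toLinearMap)) = 0 ↔
        ∀ u v : GroupLieAlgebra (𝓡 6) G, z i ⁅u, v⁆ = 0 := fun z i => by
    rw [extDer_oneForm, leftInvForm_eq_zero_iff, funext_iff]
    exact ⟨fun h u v => neg_eq_zero.mp (h ![u, v]), fun h v => neg_eq_zero.mpr (h _ _)⟩
  have hiff' : ∀ z : Fin 3 → GroupLieAlgebra (𝓡 6) G →ₗ[ℝ] ℂ,
      extDer (oneForm (fun x : G => z 2 ∘ₗ (toIdentityEquiv x).toLinearMap)) = leftInvForm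
        (fun v => twoForm ρ κ μ 0 D (z 0 (v 0)) (z 1 (v 0)) (z 0 (v 1)) (z 1 (v 1))) ↔
        ∀ u v : GroupLieAlgebra (𝓡 6) G,
          z 2 ⁅u, v⁆ = -twoForm ρ κ μ 0 D (z 0 u) (z 1 u) (z 0 v) (z 1 v) := fun z => by
    rw [extDer_oneForm, leftInvForm_injective.eq_iff, funext_iff]
    exact ⟨fun h u v => neg_eq_iff_eq_neg.mp (h ![u, v]), fun h v => neg_eq_iff_eq_neg.mpr (h _ _)⟩
  constructor
  · rintro ⟨η, hη, h0, h1, h2⟩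
    obtain ⟨z, rfl⟩ : ∃ z : Fin 3 → GroupLieAlgebra (𝓡 6) G →ₗ[ℝ] ℂ,
        η = fun i x => z i ∘ₗ (toIdentityEquiv x).toLinearMap :=
      ⟨fun i => η i 1, funext hη.eq_comp⟩
    exact ⟨z, isLeftInvariantCoframe_comp_iff.mp hη, (hiff z 0).mp h0, (hiff z 1).mp h1,
      (hiff' z).mp (h2.trans (hform z))⟩
  · rintro ⟨z, hz, h0, h1, h2⟩
    exact ⟨_, isLeftInvariantCoframe_comp_iff.mpr hz, (hiff z 0).mpr h0, (hiff z 1).mpr h1,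
      ((hiff' z).mpr h2).trans (hform z).symm⟩

theorem exists_isPluriclosed {ρ κ μ D : ℂ} (hp : PluriclosedCoeff ρ κ μ 0 D)
    (h : HasStructureEquations 𝒥 ρ κ μ D) :
    ∃ h : LeftInvariantHermitianMetric 𝒥, IsPluriclosed h := by
  obtain ⟨z, hz, h0, h1, h2⟩ := hasStructureEquations_iff.mp h
  exact ⟨metricOfInner _ (hz.isHermitianPair (atOne_atOne 𝒥) (nijenhuis_atOne 𝒥)),
    isPluriclosed_metricOfInner _ (hz.dTorsion_eq_zero h0 h1 h2 hp)⟩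

end Group

end

end NilSKT

end

theorem theorem3 {G : Type*} [TopologicalSpace G] [ChartedSpace (EuclideanSpace ℝ (Fin 6)) G]
    [Group G] [LieGroup (𝓡 6) ∞ G] [SimplyConnectedSpace G]
    [LieRing.IsNilpotent (GroupLieAlgebra (𝓡 6) G)]
    (Γ : Subgroup G) [DiscreteTopology Γ] [CompactSpace (Quotient (QuotientGroup.rightRel Γ))]
    (𝒥 : NilSKT.LeftInvariantComplexStructure G) :
    (∃ h : NilSKT.LeftInvariantHermitianMetric 𝒥, NilSKT.IsPluriclosed h) ↔
      (NilSKT.IsH1 G ∧ NilSKT.HasStructureEquations 𝒥 0 0 0 0) ∨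
      (NilSKT.IsH2 G ∧ NilSKT.HasStructureEquations 𝒥 0 1 0 Complex.I) ∨
      (NilSKT.IsH2 G ∧ ∃ D : ℂ, D.re = 1 ∧ 0 < D.im ∧
        NilSKT.HasStructureEquations 𝒥 1 1 1 D) ∨
      (NilSKT.IsH4 G ∧ NilSKT.HasStructureEquations 𝒥 1 1 1 1) ∨
      (NilSKT.IsH5 G ∧ ∃ y : ℝ, 0 < y ∧ 4 * y ^ 2 < 3 ∧
        NilSKT.HasStructureEquations 𝒥 1 1 0 (1 / 2 + Complex.I * y)) ∨
      (NilSKT.IsH5 G ∧ NilSKT.HasStructureEquations 𝒥 1 1 0 (1 / 2)) ∨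
      (NilSKT.IsH8 G ∧ NilSKT.HasStructureEquations 𝒥 0 1 0 0) := by
  open NilSKT in
  constructor
  · rintro ⟨h, hp⟩
    have hdim := finrank_groupLieAlgebra (G := G)
    obtain ⟨ρ, A, B, C, D, hc, hcoeff⟩ := h.isHermitianPair.exists_hasCoframe hdim
      (h.isHermitianPair.dTorsion_eq_zero_of_pluriclosed ((isPluriclosed_iff h).mp hp))
    rcases hc.normal_form hcoeff with hc | hc | ⟨D, hre, him, hc⟩ | hc | ⟨y, hy, hy', hc⟩ | hc | hc
    · exact .inl ⟨hc.h1 hdim, hasStructureEquations_iff.mpr hc⟩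
    · exact .inr <| .inl ⟨hc.h2_of_abelian hdim, hasStructureEquations_iff.mpr hc⟩
    · exact .inr <| .inr <| .inl ⟨hc.h2_of_re_eq_one hdim hre him.ne', D, hre, him,
        hasStructureEquations_iff.mpr hc⟩
    · exact .inr <| .inr <| .inr <| .inl ⟨hc.h4 hdim, hasStructureEquations_iff.mpr hc⟩
    · refine .inr <| .inr <| .inr <| .inr <| .inl ⟨hc.h5 hdim ?_ ?_, y, hy, hy',
        hasStructureEquations_iff.mpr hc⟩
      · simp
      · simp [Complex.normSq_apply]
        nlinarith
    · refine .inr <| .inr <| .inr <| .inr <| .inr <| .inl ⟨hc.h5 hdim ?_ ?_,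
        hasStructureEquations_iff.mpr hc⟩
      · simp
      · simp
        norm_num
    · exact .inr <| .inr <| .inr <| .inr <| .inr <| .inr
        ⟨hc.h8 hdim, hasStructureEquations_iff.mpr hc⟩
  · rintro (⟨-, h⟩ | ⟨-, h⟩ | ⟨-, D, hre, -, h⟩ | ⟨-, h⟩ | ⟨-, y, -, -, h⟩ | ⟨-, h⟩ | ⟨-, h⟩)
    all_goals refine exists_isPluriclosed ?_ h
    all_goals simp [PluriclosedCoeff, *]
    all_goals norm_num
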